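/- **Conventions.** Let $A$ be a group and $X\subseteq A$ a finite generating set. Put $X^{\pm}=X\cup X^{-1}$; $|g|_Z$ denotes the least length of a word over $Z^\pm$ representing $g\in\langle Z\rangle$, and $d_X(g,h)=|g^{-1}h|_X$ is the Cayley graph metric. $\mathrm{Geo}(A,X)$ is the set of words over $X^\pm$ of minimal length among the words representing the same element, $\epsilon$ is the empty word, and $w(t)$ is the element represented by the prefix of $w$ of length $t$ (by $w$ itself if $t>|w|$). Let $H\le A$ be a finitely generated subgroup. A *coset language* for $(A,H)$ over $X$ is a set of words over $X^\pm$ containing at least one representative of every right coset $Hg$. A *strong synchronous automatic coset system* for $(A,H)$ over $X$ is a regular coset language $L$ together with a constant $K$ such that, whenever $v,w\in L$ and $h\in H$ satisfy $d_X(v,hw)\le 1$, one has $d_X(v(t),h\,w(t))\le K$ for all $t\in\mathbb N$. The pair $(A,H)$ is *strongly synchronously coset automatic* if it has such a system over some finite generating set of $A$; it is so with coset language $L$ over a given $X$ if $L$, with some $K$, is such a system over $X$. If $Y,Z\subseteq A$ are finite and $H=\langle Y\rangle$, then $L$ has *limited crossover* with respect to $(Y,Z)$ if there is an integer $\lambda\ge1$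 such that, for all $g\in\langle Z\rangle$ with $|g|_Z\le\lambda$ and all $u,v\in L$ with $ug\in Hv$, one has $|ugv^{-1}|_Y\le\lambda$. An isomorphism $\phi:H_1=\langle Y_1\rangle\to H_2=\langle Y_2\rangle$ is *1-stable* with respect to $(Y_1,Y_2)$ if $|h|_{Y_1}\le1$ implies $|\phi(h)|_{Y_2}\le1$. A directed graph $\Lambda=(V,\vec E)$ here comes with maps $\iota,\tau:\vec E\to V$ (initial and terminal vertex) and a fixed-point-free involution $e\mapsto\bar e$ of $\vec E$ such that $\iota(\bar e)=\tau(e)$ and $\tau(\bar e)=\iota(e)$. A *graph of groups* $\mathcal G$ over $\Lambda$ consists of groups $G_v$ ($v\in V$), subgroups $G_e\le G_{\tau(e)}$ ($e\in\vec E$), and isomorphisms $\phi_e:G_e\to G_{\bar e}$ with $\phi_{\bar e}=\phi_e^{-1}$. For a maximal tree $\mathcal T$ of $\Lambda$, $\pi_1(\mathcal G)=\pi_1(\mathcal G,\mathcal T)$ is the group generated by the disjoint union of the groups $G_v$ and symbols $s_e$ ($e\in\vec E$), subject to the relations of the groups $G_v$ and: $s_{\bar e}=s_e^{-1}$ for all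 $e$; $s_e=1$ for $e\in\mathcal T$; $s_egs_e^{-1}=\phi_e(g)$ for all $e$ and $g\in G_e$. The group $G_{e}$ is regarded as a subgroup of $\pi_1(\mathcal G)$ through the canonical map $G_{\tau(e)}\to\pi_1(\mathcal G)$. **Theorem.** Let $\mathcal G$ be a graph of groups over a finite connected directed graph $\Lambda=(V,\vec E)$, let $e_0\in\vec E$ and let $\mathcal T$ be a maximal tree of $\Lambda$. Let $X_v$ and $Y_e$ be finite generating sets of $G_v$ ($v\in V$) and $G_e$ ($e\in\vec E$), and suppose that the following hold for every $e\in\vec E$. 1. $Y_e\subseteq X_{\tau(e)}$. 2. The pair $(G_{\tau(e)},G_e)$ is strongly synchronously coset automatic with a coset language $L^e_{\tau(e)}$ over $X_{\tau(e)}$ such that: every word of $L^e_{\tau(e)}$ lies in $\mathrm{Geo}(G_{\tau(e)},X_{\tau(e)})$ and does not begin with a letter of $Y_e^{\pm}$; the only representative in $L^e_{\tau(e)}$ of the identity coset $G_e$ is $\epsilon$; and each $g\in G_{\tau(e)}$ is represented by a word $y_gz_g\in\mathrm{Geo}(G_{\tau(e)},X_{\tau(e)})$ with $y_g$ a word over $Y_e^\pm$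 and $z_g\in L^e_{\tau(e)}$. 3. $\phi_e:G_e\to G_{\bar e}$ is 1-stable with respect to $(Y_e,Y_{\bar e})$. 4. For each $f\in\vec E$ with $\tau(f)=\tau(e)$, the language $L^e_{\tau(e)}$ has limited crossover with respect to $(Y_e,Y_f)$. Then the pair $(\pi_1(\mathcal G),G_{e_0})$ is strongly synchronously coset automatic. -/

import Mathlib

namespace GOG

section Words

variable {A : Type*} [Group A]

/-- `w` is a word over `X^± = X ∪ X⁻¹`, the letters being elements of the group. -/
def IsWordOver (X : Set A) (w : List A) : Prop :=
  ∀ x ∈ w, x ∈ X ∨ x⁻¹ ∈ X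

/-- The `X`-length `|g|_X` of `g`: the least length of a word over `X^±` that represents `g`
(it is `⊤` if `g` does not lie in the subgroup generated by `X`). -/
noncomputable def wordLength (X : Set A) (g : A) : ℕ∞ :=
  ⨅ w : {w : List A // IsWordOver X w ∧ w.prod = g}, (w.1.length : ℕ∞)

theorem wordLength_le_iff (X : Set A) (g : A) (n : ℕ) :
    wordLength X g ≤ n ↔ ∃ w : List A, IsWordOver X w ∧ w.prod = g ∧ w.length ≤ n := by
  constructor
  · intro h
    by_contra! hc
    have h1 : ((n + 1 : ℕ) : ℕ∞) ≤ wordLength X g := by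
      refine le_iInf fun w => ?_
      exact_mod_cast hc w.1 w.2.1 w.2.2
    have h2 : ((n + 1 : ℕ) : ℕ∞) ≤ (n : ℕ∞) := h1.trans h
    have h3 : n + 1 ≤ n := by exact_mod_cast h2
    omega
  · rintro ⟨w, hw, hg, hn⟩
    refine (iInf_le _ (⟨w, hw, hg⟩ : {w : List A // IsWordOver X w ∧ w.prod = g})).trans ?_
    exact_mod_cast hn

/-- The path metric of the Cayley graph of the group with respect to `X`, whose edges join
`g` to `g * x`. -/
noncomputable def cayleyDist (X : Set A) (g h : A) : ℕ∞ :=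
  wordLength X (g⁻¹ * h)

/-- The language of geodesic words over `X^±`. -/
def Geo (X : Set A) : Language A :=
  {w | IsWordOver X w ∧ ∀ w' : List A, IsWordOver X w' → w'.prod = w.prod → w.length ≤ w'.length}

/-- The path labelled `v` from `1` and the path labelled `w` from `h` synchronously
`K`-fellow travel. The element `w(t)` represented by the prefix of length `t` (by the whole word,
if `t` exceeds its length) is `(w.take t).prod`. -/
def SyncFellowTravel (X : Set A) (K : ℕ) (v : List A) (h : A) (w : List A) : Prop :=
  ∀ t : ℕ, cayleyDist X (v.take t).prod (h * (w.take t).prod) ≤ K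

/-- `L` is a coset language for `(A, H)` over `X`: a set of words over `X^±` that contains a
representative of each right coset `Hg`. -/
structure IsCosetLanguage (X : Set A) (H : Subgroup A) (L : Language A) : Prop where
  isWordOver : ∀ w ∈ L, IsWordOver X w
  exists_rep : ∀ g : A, ∃ w ∈ L, ∃ h ∈ H, w.prod = h * g

/-- `L` together with the constant `K` is a strong synchronous automatic coset system for
`(A, H)` over `X`. -/
structure IsStrongSyncCosetSystem (X : Set A) (H : Subgroup A) (L : Language A) (K : ℕ) :
    Prop where
  isCosetLanguage : IsCosetLanguage X H L
  isRegular : L.IsRegular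
  fellowTravel : ∀ v ∈ L, ∀ w ∈ L, ∀ h ∈ H,
    cayleyDist X v.prod (h * w.prod) ≤ 1 → SyncFellowTravel X K v h w

/-- The pair `(A, H)` is strongly synchronously coset automatic: it has a strong synchronous
automatic coset system over some finite generating set. -/
def StronglySyncCosetAutomatic (H : Subgroup A) : Prop :=
  ∃ X : Set A, X.Finite ∧ Subgroup.closure X = ⊤ ∧
    ∃ (L : Language A) (K : ℕ), IsStrongSyncCosetSystem X H L K

/-- `L`, a coset language for `(A, ⟨Y⟩)`, has `l`-limited crossover with respect to `(Y, Z)`. -/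
def HasLimitedCrossoverWith (l : ℕ) (L : Language A) (Y Z : Set A) : Prop :=
  ∀ g ∈ Subgroup.closure Z, wordLength Z g ≤ l → ∀ u ∈ L, ∀ v ∈ L,
    u.prod * g * v.prod⁻¹ ∈ Subgroup.closure Y →
      wordLength Y (u.prod * g * v.prod⁻¹) ≤ l

/-- `L` has limited crossover with respect to `(Y, Z)`. -/
def HasLimitedCrossover (L : Language A) (Y Z : Set A) : Prop :=
  ∃ l : ℕ, 1 ≤ l ∧ HasLimitedCrossoverWith l L Y Z

/-- The triple `(H₁, H₂, f)` is `m`-stable with respect to `(Y₁, Y₂)`, where `Y₁` and `Y₂`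
generate `H₁` and `H₂`. -/
def IsStable {B : Type*} [Group B] (m : ℕ) {H₁ : Subgroup A} {H₂ : Subgroup B}
    (f : H₁ ≃* H₂) (Y₁ : Set A) (Y₂ : Set B) : Prop :=
  ∀ h : H₁, wordLength Y₁ (h : A) ≤ m → wordLength Y₂ (f h : B) ≤ m

end Words

/-- A directed graph in which each directed edge `e` comes with the oppositely oriented
edge `bar e`. -/
structure DirGraph (V E : Type*) where
  ι : E → V
  τ : E → V
  bar : E → E
  bar_bar : ∀ e, bar (bar e) = e
  bar_ne : ∀ e, bar e ≠ e
  ι_bar : ∀ e, ι (bar e) = τ e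
  τ_bar : ∀ e, τ (bar e) = ι e

namespace DirGraph

variable {V E : Type*} (Γ : DirGraph V E)

/-- The list `p` of edges is a directed path from `v` to `w`. -/
def IsPath : V → List E → V → Prop
  | v, [], w => v = w
  | v, e :: p, w => Γ.ι e = v ∧ IsPath (Γ.τ e) p w

/-- The graph is connected (and non-empty). -/
def Connected : Prop :=
  Nonempty V ∧ ∀ v w : V, ∃ p : List E, Γ.IsPath v p w

/-- A path without backtracking. -/
def IsReduced (p : List E) : Prop :=
  p.IsChain fun e f => f ≠ Γ.bar e

/-- `T` is the set of directed edges of a maximal tree of a connected graph, that is, of a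
subgraph that contains every vertex, is connected and has no circuits. -/
structure IsMaximalTree (T : Set E) : Prop where
  bar_mem : ∀ e ∈ T, Γ.bar e ∈ T
  exists_path : ∀ v w : V, ∃ p : List E, Γ.IsPath v p w ∧ ∀ e ∈ p, e ∈ T
  acyclic : ∀ (v : V) (p : List E), Γ.IsPath v p v → (∀ e ∈ p, e ∈ T) → Γ.IsReduced p → p = []

end DirGraph

/-- The edge groups `G_e ≤ G_{τ(e)}` and the isomorphisms `φ_e : G_e → G_{bar e}` of a graph of
groups over `Γ` with vertex groups `G v`. -/
structure GraphOfGroups {V E : Type*} (Γ : DirGraph V E) (G : V → Type*)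
    [∀ v, Group (G v)] where
  edgeGroup : ∀ e : E, Subgroup (G (Γ.τ e))
  φ : ∀ e : E, edgeGroup e ≃* edgeGroup (Γ.bar e)
  /-- `φ_{bar e}` is the inverse of `φ_e`; the equality is one of dependent pairs because
  `bar (bar e) = e` holds only propositionally. -/
  φ_bar : ∀ (e : E) (g : edgeGroup e),
    (⟨Γ.bar (Γ.bar e), φ (Γ.bar e) (φ e g)⟩ : Σ e : E, edgeGroup e) = ⟨e, g⟩

namespace GraphOfGroups

variable {V E : Type*} {Γ : DirGraph V E} {G : V → Type*} [∀ v, Group (G v)]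

/-- The generator of the fundamental group given by the element `g` of `G_v`. -/
def genV (E : Type*) {V : Type*} {G : V → Type*} (v : V) (g : G v) :
    FreeGroup ((Σ v, G v) ⊕ E) :=
  FreeGroup.of (Sum.inl ⟨v, g⟩)

/-- The generator `s_e` of the fundamental group. -/
def genE {V : Type*} {E : Type*} (G : V → Type*) (e : E) : FreeGroup ((Σ v, G v) ⊕ E) :=
  FreeGroup.of (Sum.inr e)

/-- The relators of the fundamental group at `T`. -/
inductive Relator (𝒢 : GraphOfGroups Γ G) (T : Set E) : FreeGroup ((Σ v, G v) ⊕ E) → Prop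
  /-- the multiplication table of `G_v` -/
  | mul (v : V) (a b : G v) :
      Relator 𝒢 T (genV E v a * genV E v b * (genV E v (a * b))⁻¹)
  /-- `s_{bar e} = s_e⁻¹` -/
  | bar (e : E) : Relator 𝒢 T (genE G (Γ.bar e) * genE G e)
  /-- `s_e = 1` for `e` in the tree -/
  | tree (e : E) (he : e ∈ T) : Relator 𝒢 T (genE G e)
  /-- `s_e g s_e⁻¹ = φ_e(g)` for `g ∈ G_e` -/
  | conj (e : E) (g : 𝒢.edgeGroup e) :
      Relator 𝒢 T (genE G e * genV E (Γ.τ e) (g : G (Γ.τ e)) * (genE G e)⁻¹ *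
        (genV E (Γ.τ (Γ.bar e)) (𝒢.φ e g : G (Γ.τ (Γ.bar e))))⁻¹)

/-- The fundamental group of the graph of groups at the maximal tree `T`. -/
abbrev Pi1 (𝒢 : GraphOfGroups Γ G) (T : Set E) : Type _ :=
  PresentedGroup {r | Relator 𝒢 T r}

/-- The canonical homomorphism from a vertex group to the fundamental group. -/
def ofVertex (𝒢 : GraphOfGroups Γ G) (T : Set E) (v : V) : G v →* Pi1 𝒢 T :=
  MonoidHom.mk' (fun g => PresentedGroup.mk {r | Relator 𝒢 T r} (genV E v g)) fun a b => by
    have h : PresentedGroup.mk {r | Relator 𝒢 T r}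
        (genV E v a * genV E v b * (genV E v (a * b))⁻¹) = 1 :=
      PresentedGroup.one_of_mem (Relator.mul v a b)
    rw [map_mul, map_mul, map_inv, mul_inv_eq_one] at h
    exact h.symm

/-- The edge group `G_e`, as a subgroup of the fundamental group. -/
def edgeSubgroup (𝒢 : GraphOfGroups Γ G) (T : Set E) (e : E) : Subgroup (Pi1 𝒢 T) :=
  (𝒢.edgeGroup e).map (𝒢.ofVertex T (Γ.τ e))

end GraphOfGroups

end GOG

/-! All vertex groups are embedded in their direct product `A`, so that each edge becomes a partial
isomorphism between subgroups of `A`. Elements of the fundamental group are spelled by path words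
that start at the vertex τ(e₀): generators read at the current vertex, and edges. Such a path is cut
by its edges into segments. The coset language consists of the closed paths without backtracking
whose segments lie in the languages L^e (e being the edge just crossed, or e₀ at the start), and
which are shortest among all path words with the same end vertex in the same right coset of G_{e₀}.

Representatives exist because a segment followed by a generator can be rewritten as `y z` with `y`
over Y_e and `z` in L^e. By 1-stability `y` crosses the edge without becoming longer, and the
process continues to the left until an element of G_{e₀} drops out. Thus every path word becomes a
reduced path of no greater length in the same coset (`exists_isLPath`).

Fellow travelling rests on the normal form theorem (`matched_of_eval`, `matched_of_val_eq`): two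
reduced paths that differ by `g` at the right-hand end and by an element of G_{e₀} on the left cross
the same edges, and the discrepancy `g` passes leftwards from segment to segment. With one crossover
constant Λ for all pairs of edges, the discrepancy at every edge has length at most Λ over Y_e, so
corresponding segments fellow travel. These segments may start at different times, but if the two
words are minimal up to each edge, then the lag is at most Λ. This makes the travel synchronous
(`syncFellowTravel_of_nodesMin`). Elements at distance 1 are joined by a path word of bounded
length, and minimal paths to its intermediate vertices form a chain (`syncFellowTravel_chain`).

Regularity: reduced paths are recognised by a finite parser. If a reduced path is not minimal, the
shortest non-minimal initial subpath that ends with a segment has minimal proper subpaths, hence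
fellow travels with a strictly shorter word in its coset. An automaton comparing two words detects
this, so minimality is a regular condition (`isRegular_minLanguage`). -/

namespace GOG

/-! ### Word length, Cayley distance and fellow travelling -/

section WordMetric

variable {A : Type*} [Group A] {X : Set A}

theorem IsWordOver.nil : IsWordOver X ([] : List A) := fun _ h => by simp at h

theorem IsWordOver.append {u v : List A} (hu : IsWordOver X u) (hv : IsWordOver X v) :
    IsWordOver X (u ++ v) := fun x hx => by
  rcases List.mem_append.1 hx with h | h
  exacts [hu x h, hv x h]

theorem IsWordOver.mono {Z : Set A} (h : X ⊆ Z) {u : List A} (hu : IsWordOver X u) :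
    IsWordOver Z u := fun x hx => (hu x hx).imp (fun k => h k) (fun k => h k)

theorem IsWordOver.take {u : List A} (hu : IsWordOver X u) (n : ℕ) : IsWordOver X (u.take n) :=
  fun x hx => hu x (List.mem_of_mem_take hx)

theorem IsWordOver.drop {u : List A} (hu : IsWordOver X u) (n : ℕ) : IsWordOver X (u.drop n) :=
  fun x hx => hu x (List.mem_of_mem_drop hx)

theorem IsWordOver.reverse_inv {u : List A} (hu : IsWordOver X u) :
    IsWordOver X (u.map (·⁻¹)).reverse := fun x hx => by
  simp only [List.mem_reverse, List.mem_map] at hx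
  obtain ⟨y, hy, rfl⟩ := hx
  rcases hu y hy with h | h
  · exact Or.inr (by simpa using h)
  · exact Or.inl h

theorem IsWordOver.prod_mem {u : List A} (hu : IsWordOver X u) :
    u.prod ∈ Subgroup.closure X := by
  refine Subgroup.list_prod_mem _ fun x hx => ?_
  rcases hu x hx with h | h
  · exact Subgroup.subset_closure h
  · exact (Subgroup.inv_mem_iff _).1 (Subgroup.subset_closure h)

theorem exists_isWordOver_of_mem_closure {g : A} (hg : g ∈ Subgroup.closure X) :
    ∃ w : List A, IsWordOver X w ∧ w.prod = g := by
  induction hg using Subgroup.closure_induction with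
  | mem x hx => exact ⟨[x], fun y hy => by simp_all, by simp⟩
  | one => exact ⟨[], IsWordOver.nil, rfl⟩
  | mul x y _ _ hx hy =>
    obtain ⟨u, hu, rfl⟩ := hx
    obtain ⟨v, hv, rfl⟩ := hy
    exact ⟨u ++ v, hu.append hv, List.prod_append⟩
  | inv x _ hx =>
    obtain ⟨u, hu, rfl⟩ := hx
    exact ⟨_, hu.reverse_inv, by rw [List.prod_inv_reverse]⟩

theorem IsWordOver.wordLength_le {w : List A} (hw : IsWordOver X w) :
    wordLength X w.prod ≤ (w.length : ℕ) :=
  (wordLength_le_iff X _ _).2 ⟨w, hw, rfl, le_rfl⟩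

theorem wordLength_one_le (n : ℕ) : wordLength X (1 : A) ≤ n :=
  (wordLength_le_iff X _ _).2 ⟨[], IsWordOver.nil, rfl, by simp⟩

theorem wordLength_le_of_le {g : A} {m n : ℕ} (h : wordLength X g ≤ m) (hmn : m ≤ n) :
    wordLength X g ≤ n := h.trans (by exact_mod_cast hmn)

theorem wordLength_mul_le {g h : A} {m n : ℕ} (hg : wordLength X g ≤ m)
    (hh : wordLength X h ≤ n) : wordLength X (g * h) ≤ (m + n : ℕ) := by
  obtain ⟨u, hu, rfl, hm⟩ := (wordLength_le_iff X _ _).1 hg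
  obtain ⟨v, hv, rfl, hn⟩ := (wordLength_le_iff X _ _).1 hh
  exact (wordLength_le_iff X _ _).2 ⟨u ++ v, hu.append hv, List.prod_append, by simp; omega⟩

theorem wordLength_inv_le {g : A} {n : ℕ} (hg : wordLength X g ≤ n) :
    wordLength X g⁻¹ ≤ n := by
  obtain ⟨u, hu, rfl, hm⟩ := (wordLength_le_iff X _ _).1 hg
  exact (wordLength_le_iff X _ _).2 ⟨_, hu.reverse_inv, by rw [List.prod_inv_reverse], by simpa⟩

theorem wordLength_anti {Z : Set A} (h : X ⊆ Z) {g : A} {n : ℕ} (hg : wordLength X g ≤ n) :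
    wordLength Z g ≤ n := by
  obtain ⟨u, hu, rfl, hm⟩ := (wordLength_le_iff X _ _).1 hg
  exact (wordLength_le_iff Z _ _).2 ⟨u, hu.mono h, rfl, hm⟩

theorem wordLength_map_le {C : Type*} [Group C] {Z : Set C} (f : A →* C)
    (hf : ∀ x ∈ X, f x ∈ Z) {g : A} {n : ℕ} (hg : wordLength X g ≤ n) :
    wordLength Z (f g) ≤ n := by
  obtain ⟨u, hu, rfl, hm⟩ := (wordLength_le_iff X _ _).1 hg
  refine (wordLength_le_iff Z _ _).2 ⟨u.map f, fun x hx => ?_, by rw [map_list_prod], by simpa⟩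
  obtain ⟨y, hy, rfl⟩ := List.mem_map.1 hx
  exact (hu y hy).imp (hf y) fun h => by rw [← map_inv]; exact hf _ h

theorem mem_closure_of_wordLength_le {g : A} {n : ℕ} (hg : wordLength X g ≤ n) :
    g ∈ Subgroup.closure X := by
  obtain ⟨u, hu, rfl, -⟩ := (wordLength_le_iff X _ _).1 hg
  exact hu.prod_mem

theorem finite_ball (hX : X.Finite) (n : ℕ) : {g : A | wordLength X g ≤ n}.Finite := by
  induction n with
  | zero =>
    refine (Set.finite_singleton (1 : A)).subset fun g hg => ?_
    obtain ⟨u, -, rfl, hm⟩ := (wordLength_le_iff X _ _).1 hg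
    simp_all
  | succ n ih =>
    refine ((Set.Finite.image2 (· * ·) (hX.union hX.inv) ih).union ih).subset fun g hg => ?_
    obtain ⟨u, hu, rfl, hm⟩ := (wordLength_le_iff X _ _).1 hg
    cases u with
    | nil => exact Or.inr (wordLength_one_le n)
    | cons x u =>
      refine Or.inl ⟨x, ?_, u.prod, ?_, by simp⟩
      · exact hu x (by simp)
      · exact (wordLength_le_iff X _ _).2
          ⟨u, fun y hy => hu y (by simp [hy]), rfl, by simpa using hm⟩

theorem exists_wordLength_bound {S : Set A} (hS : S.Finite) (hSX : S ⊆ Subgroup.closure X) :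
    ∃ N : ℕ, ∀ g ∈ S, wordLength X g ≤ N := by
  induction S, hS using Set.Finite.induction_on with
  | empty => exact ⟨0, by simp⟩
  | @insert a S _ _ ih =>
    obtain ⟨N, hN⟩ := ih ((Set.subset_insert _ _).trans hSX)
    obtain ⟨w, hw, rfl⟩ := exists_isWordOver_of_mem_closure (hSX (Set.mem_insert _ _))
    refine ⟨max N w.length, fun g hg => ?_⟩
    rcases hg with rfl | hg
    · exact wordLength_le_of_le hw.wordLength_le (le_max_right _ _)
    · exact wordLength_le_of_le (hN g hg) (le_max_left _ _)

theorem cayleyDist_triangle {g h k : A} {m n : ℕ} (h₁ : cayleyDist X g h ≤ m)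
    (h₂ : cayleyDist X h k ≤ n) : cayleyDist X g k ≤ (m + n : ℕ) := by
  have := wordLength_mul_le h₁ h₂
  rwa [mul_assoc, mul_inv_cancel_left] at this

theorem cayleyDist_comm_le {g h : A} {n : ℕ} (h₁ : cayleyDist X g h ≤ n) :
    cayleyDist X h g ≤ n := by
  have := wordLength_inv_le h₁
  rwa [mul_inv_rev, inv_inv] at this

theorem cayleyDist_mul_left (a g h : A) : cayleyDist X (a * g) (a * h) = cayleyDist X g h := by
  unfold cayleyDist; congr 1; group

theorem cayleyDist_take_le {w : List A} (hw : IsWordOver X w) {s t n : ℕ} (h₁ : s ≤ t + n)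
    (h₂ : t ≤ s + n) : cayleyDist X (w.take s).prod (w.take t).prod ≤ n := by
  wlog h : s ≤ t generalizing s t
  · exact cayleyDist_comm_le (this h₂ h₁ (by omega))
  obtain ⟨k, rfl⟩ := Nat.exists_eq_add_of_le h
  rw [cayleyDist, List.take_add, List.prod_append, inv_mul_cancel_left]
  exact wordLength_le_of_le ((hw.drop s).take k).wordLength_le (by simp; omega)

theorem SyncFellowTravel.trans {K M : ℕ} {u v w : List A} {g h : A}
    (h₁ : SyncFellowTravel X K u g v) (h₂ : SyncFellowTravel X M v h w) :
    SyncFellowTravel X (K + M) u (g * h) w := fun t => by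
  refine cayleyDist_triangle (h₁ t) ?_
  rw [mul_assoc, cayleyDist_mul_left]
  exact h₂ t

theorem SyncFellowTravel.mono {K M : ℕ} {u v : List A} {g : A}
    (h₁ : SyncFellowTravel X K u g v) (h : K ≤ M) :
    SyncFellowTravel X M u g v := fun t => wordLength_le_of_le (h₁ t) h

end WordMetric

/-! ### Consequences of a strong synchronous coset system -/

section CosetSystem

variable {A : Type*} [Group A] {X : Set A} {H : Subgroup A} {L : Language A} {K : ℕ}

/-- A path of length `n` from `u` to `h v` is followed letter by letter, with a representative in
`L` of each coset on the way; neighbouring representatives `K`-fellow travel. The case of distance 0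
already costs one `K`, whence `n + 1`. -/
theorem IsStrongSyncCosetSystem.syncFellowTravel_of_cayleyDist_le
    (hS : IsStrongSyncCosetSystem X H L K) (n : ℕ) {u v : List A} (hu : u ∈ L) (hv : v ∈ L)
    {h : A} (hh : h ∈ H) (hd : cayleyDist X u.prod (h * v.prod) ≤ n) :
    SyncFellowTravel X ((n + 1) * K) u h v := by
  induction n generalizing u h with
  | zero => simpa using hS.fellowTravel u hu v hv h hh (hd.trans (by simp))
  | succ n ih =>
    obtain ⟨w, hw, hwp, hwn⟩ := (wordLength_le_iff X _ _).1 hd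
    obtain ⟨x, w', hxw, hx, hw', hw'n⟩ : ∃ (x : A) (w' : List A), w.prod = x * w'.prod ∧
        wordLength X x ≤ 1 ∧ IsWordOver X w' ∧ w'.length ≤ n := by
      cases w with
      | nil => exact ⟨1, [], by simp, by exact_mod_cast wordLength_one_le 1, hw, by simp⟩
      | cons x w =>
        refine ⟨x, w, by simp, ?_, fun y hy => hw y (by simp [hy]), by simpa using hwn⟩
        have : IsWordOver X [x] := fun y hy => hw y (by simp_all)
        simpa using this.wordLength_le
    obtain ⟨u₁, hu₁, h₁, hh₁, hp⟩ := hS.isCosetLanguage.exists_rep (u.prod * x)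
    have e₁ : SyncFellowTravel X K u h₁⁻¹ u₁ := by
      refine hS.fellowTravel u hu u₁ hu₁ _ (H.inv_mem hh₁) ?_
      rw [cayleyDist, hp]
      simpa using hx
    have e₂ : SyncFellowTravel X ((n + 1) * K) u₁ (h₁ * h) v := by
      refine ih hu₁ (H.mul_mem hh₁ hh) ?_
      have : u₁.prod⁻¹ * (h₁ * h * v.prod) = w'.prod := by
        rw [hp]
        have : h * v.prod = u.prod * (x * w'.prod) := by rw [← hxw, hwp]; group
        rw [mul_assoc, this]; group
      rw [cayleyDist, this]
      exact wordLength_le_of_le hw'.wordLength_le hw'n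
    have := e₁.trans e₂
    rw [inv_mul_cancel_left] at this
    exact this.mono (by ring_nf; omega)

/-- A word of length `(n + 1) * l` is cut into blocks of length `l`, with a representative in `L`
inserted after each block; every block contributes at most `l`. The definition uses one number both
as hypothesis and as bound, so passing to larger constants is not automatic; multiples suffice
later. -/
theorem HasLimitedCrossoverWith.mul {Y Z : Set A} {l : ℕ}
    (hc : HasLimitedCrossoverWith l L Y Z)
    (hL : IsCosetLanguage X (Subgroup.closure Y) L) (n : ℕ) :
    HasLimitedCrossoverWith ((n + 1) * l) L Y Z := by
  induction n with
  | zero => simpa using hc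
  | succ n ih =>
    intro g hg hgl u hu v hv huv
    obtain ⟨w, hw, rfl, hwn⟩ := (wordLength_le_iff Z _ _).1 hgl
    obtain ⟨u₁, hu₁, h₁, hh₁, hp⟩ := hL.exists_rep (u.prod * (w.take l).prod)
    have e : u.prod * w.prod * v.prod⁻¹ =
        (u.prod * (w.take l).prod * u₁.prod⁻¹) * (u₁.prod * (w.drop l).prod * v.prod⁻¹) := by
      rw [← List.prod_take_mul_prod_drop w l]; group
    have m₁ : u.prod * (w.take l).prod * u₁.prod⁻¹ ∈ Subgroup.closure Y := by
      rw [hp, mul_inv_rev, mul_inv_cancel_left]; exact (Subgroup.inv_mem_iff _).2 hh₁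
    have m₂ : u₁.prod * (w.drop l).prod * v.prod⁻¹ ∈ Subgroup.closure Y := by
      rw [e] at huv
      exact (Subgroup.mul_mem_cancel_left _ m₁).1 huv
    rw [e, add_mul (n + 1), one_mul, add_comm ((n + 1) * l)]
    refine wordLength_mul_le (hc _ (hw.take l).prod_mem ?_ u hu u₁ hu₁ m₁)
      (ih _ (hw.drop l).prod_mem ?_ u₁ hu₁ v hv m₂)
    · exact wordLength_le_of_le (hw.take l).wordLength_le (by simp)
    · exact wordLength_le_of_le (hw.drop l).wordLength_le
        (by rw [add_mul (n + 1)] at hwn; simp; omega)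

/-- Fellow travelling at time 0 places the left difference itself in the `K`-ball for `X`, which
meets `⟨Y⟩` in a finite set. -/
theorem IsStrongSyncCosetSystem.exists_wordLength_bound {Y : Set A}
    (hS : IsStrongSyncCosetSystem X (Subgroup.closure Y) L K) (hX : X.Finite) :
    ∃ N : ℕ, ∀ u ∈ L, ∀ v ∈ L, ∀ x : A, wordLength X x ≤ 1 →
      u.prod * x * v.prod⁻¹ ∈ Subgroup.closure Y →
        wordLength Y (u.prod * x * v.prod⁻¹) ≤ N := by
  obtain ⟨N, hN⟩ := GOG.exists_wordLength_bound (X := Y)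
    (S := {g : A | wordLength X g ≤ K} ∩ Subgroup.closure Y)
    ((finite_ball hX K).inter_of_left _) Set.inter_subset_right
  refine ⟨N, fun u hu v hv x hx hm => hN _ ⟨?_, hm⟩⟩
  have := hS.fellowTravel u hu v hv _ hm (by rw [cayleyDist]; simpa [mul_assoc] using hx) 0
  simpa [cayleyDist] using this

end CosetSystem

/-! ### Closure properties of regular languages -/

section Regular

variable {α β : Type*}

/-- `F` is the state reached by a deterministic automaton; as it determines the left quotient,
Myhill–Nerode applies. -/
theorem isRegular_of_finite_range {σ : Type*} {L : Language α} (F : List α → σ)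
    (hfin : (Set.range F).Finite)
    (hstep : ∀ u v a, F u = F v → F (u ++ [a]) = F (v ++ [a]))
    (hacc : ∀ u v, F u = F v → u ∈ L → v ∈ L) : L.IsRegular := by
  refine Language.IsRegular.of_finite_range_leftQuotient ?_
  have key : ∀ x u v, F u = F v → F (u ++ x) = F (v ++ x) := by
    intro x
    induction x with
    | nil => simp
    | cons a x ih =>
      intro u v h
      simpa using ih _ _ (hstep u v a h)
  choose g hg using fun s : Set.range F => s.2
  have : Set.range L.leftQuotient ⊆ (fun s : Set.range F => L.leftQuotient (g s)) '' Set.univ := by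
    rintro _ ⟨u, rfl⟩
    refine ⟨⟨F u, u, rfl⟩, trivial, ?_⟩
    have h := hg ⟨F u, u, rfl⟩
    ext x
    exact ⟨hacc _ _ (key x _ _ h), hacc _ _ (key x _ _ h.symm)⟩
  have := hfin.to_subtype
  exact (Set.finite_univ.image _).subset ‹_›

theorem leftQuotient_snoc_congr {L : Language α} {u v : List α} (a : α)
    (h : L.leftQuotient u = L.leftQuotient v) :
    L.leftQuotient (u ++ [a]) = L.leftQuotient (v ++ [a]) := by
  rw [Language.leftQuotient_append, Language.leftQuotient_append, h]

theorem mem_iff_of_leftQuotient_eq {L : Language α} {u v : List α}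
    (h : L.leftQuotient u = L.leftQuotient v) : u ∈ L ↔ v ∈ L := by
  have : [] ∈ L.leftQuotient u ↔ [] ∈ L.leftQuotient v := by rw [h]
  simpa [Language.mem_leftQuotient] using this

/-- Subset construction: the state of `u` is the set of left quotients by its preimages. -/
theorem IsRegular.image_map {L : Language α} (hL : L.IsRegular) (f : α → β) :
    Language.IsRegular ((List.map f '' L : Set (List β)) : Language β) := by
  refine isRegular_of_finite_range
    (fun u => {Q | ∃ w : List α, w.map f = u ∧ L.leftQuotient w = Q}) ?_ ?_ ?_
  · refine hL.finite_range_leftQuotient.finite_subsets.subset ?_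
    rintro _ ⟨u, rfl⟩ Q ⟨w, -, rfl⟩
    exact ⟨w, rfl⟩
  · have key : ∀ u v a, {Q | ∃ w : List α, w.map f = u ∧ L.leftQuotient w = Q} =
        {Q | ∃ w : List α, w.map f = v ∧ L.leftQuotient w = Q} →
        {Q | ∃ w : List α, w.map f = u ++ [a] ∧ L.leftQuotient w = Q} ⊆
        {Q | ∃ w : List α, w.map f = v ++ [a] ∧ L.leftQuotient w = Q} := by
      rintro u v a h _ ⟨w, hw, rfl⟩
      obtain ⟨w₁, w₂, rfl, h₁, h₂⟩ := List.map_eq_append_iff.1 hw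
      obtain ⟨b, rfl, rfl⟩ := List.map_eq_singleton_iff.1 h₂
      have : L.leftQuotient w₁ ∈ {Q | ∃ w : List α, w.map f = u ∧ L.leftQuotient w = Q} :=
        ⟨w₁, h₁, rfl⟩
      rw [h] at this
      obtain ⟨w', hw', hq⟩ := this
      exact ⟨w' ++ [b], by simp [hw'], leftQuotient_snoc_congr b hq⟩
    exact fun u v a h => (key u v a h).antisymm (key v u a h.symm)
  · rintro u v h ⟨w, hw, rfl⟩
    have : L.leftQuotient w ∈ {Q | ∃ w' : List α, w'.map f = w.map f ∧ L.leftQuotient w' = Q} :=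
      ⟨w, rfl, rfl⟩
    change _ = _ at h
    rw [h] at this
    obtain ⟨w', hw', hq⟩ := this
    exact ⟨w', (mem_iff_of_leftQuotient_eq hq).2 hw, hw'⟩

/-- The left quotient is tracked together with one bit that remembers whether some prefix was
accepted. -/
theorem IsRegular.prefix_mem {L : Language α} (hL : L.IsRegular) :
    Language.IsRegular ({u | ∃ v x, u = v ++ x ∧ v ∈ L} : Set (List α)) := by
  refine isRegular_of_finite_range
    (fun u => (L.leftQuotient u, ∃ v x, u = v ++ x ∧ v ∈ L)) ?_ ?_ ?_
  · refine (hL.finite_range_leftQuotient.prod (Set.finite_univ (α := Prop))).subset ?_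
    rintro _ ⟨u, rfl⟩
    exact ⟨⟨u, rfl⟩, trivial⟩
  · intro u v a h
    have key : ∀ u : List α, (∃ w x, u ++ [a] = w ++ x ∧ w ∈ L) ↔
        (∃ w x, u = w ++ x ∧ w ∈ L) ∨ u ++ [a] ∈ L := by
      intro u
      constructor
      · rintro ⟨w, x, h, hw⟩
        rcases List.eq_nil_or_concat x with rfl | ⟨x', b, rfl⟩
        · right
          simpa [h] using hw
        · left
          rw [List.concat_eq_append, ← List.append_assoc] at h
          exact ⟨w, x', (List.append_inj' h rfl).1, hw⟩
      · rintro (⟨w, x, rfl, hw⟩ | h)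
        · exact ⟨w, x ++ [a], by simp, hw⟩
        · exact ⟨u ++ [a], [], by simp, h⟩
    obtain ⟨h₁, h₂⟩ := Prod.ext_iff.1 h
    refine Prod.ext (leftQuotient_snoc_congr a h₁) ?_
    simp only at h₁ h₂ ⊢
    rw [eq_iff_iff] at h₂ ⊢
    rw [key, key, h₂, mem_iff_of_leftQuotient_eq (leftQuotient_snoc_congr a h₁)]
  · intro u v h hu
    exact (Prod.ext_iff.1 h).2.mp hu

/-- The words of `L` that synchronously fellow travel with a shorter word of `L` in the same
right coset of `H` form a regular language. -/
theorem IsRegular.exists_shorter {P : Type*} [Group P] {X : Set P} (hX : X.Finite) (H : Subgroup P)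
    (K : ℕ) (f : α → P) {L : Language α} (hL : L.IsRegular) :
    Language.IsRegular ({u | u ∈ L ∧ ∃ w ∈ L, ∃ h ∈ H, (u.map f).prod = h * (w.map f).prod ∧
      w.length < u.length ∧ SyncFellowTravel X K (u.map f) h (w.map f)} : Set (List α)) := by
  -- For every second track that is no longer than `u` and has travelled with it so far, the state
  -- records its left quotient, the difference of the end points, and whether it has already
  -- stopped. A stopped track cannot be prolonged any more.
  let S : List α → Set (Language α × P × Prop) := fun u =>
    {x | ∃ w : List α, ∃ h ∈ H, w.length ≤ u.length ∧
      SyncFellowTravel X K (u.map f) h (w.map f) ∧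
      x = (L.leftQuotient w, (u.map f).prod⁻¹ * (h * (w.map f).prod), w.length < u.length)}
  refine isRegular_of_finite_range (fun u => (L.leftQuotient u, S u)) ?_ ?_ ?_
  · have hf := (hL.finite_range_leftQuotient.prod
      ((finite_ball hX K).prod (Set.finite_univ (α := Prop)))).finite_subsets
    refine (hL.finite_range_leftQuotient.prod hf).subset ?_
    rintro _ ⟨u, rfl⟩
    refine ⟨⟨u, rfl⟩, ?_⟩
    rintro _ ⟨w, h, hh, hl, hs, rfl⟩
    refine ⟨⟨w, rfl⟩, ?_, trivial⟩
    have := hs u.length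
    rwa [cayleyDist, List.take_of_length_le (by simp), List.take_of_length_le (by simpa)] at this
  · intro u v a h
    have key : ∀ u v, S u = S v → S (u ++ [a]) ⊆ S (v ++ [a]) := by
      rintro u v huv _ ⟨w, h, hh, hl, hs, rfl⟩
      have hlast := hs (u.length + 1)
      rw [List.take_of_length_le (by simp), List.take_of_length_le (by simpa using hl)] at hlast
      -- the second track either ended before, or it reads a letter together with the first one
      obtain ⟨w₁, w₂, rfl, hw₁, hw₂⟩ : ∃ w₁ w₂, w = w₁ ++ w₂ ∧ w₁.length ≤ u.length ∧
          (w₂ = [] ∨ w₁.length = u.length ∧ ∃ b, w₂ = [b]) := by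
        rcases Nat.lt_or_ge u.length w.length with hlt | hge
        · rcases List.eq_nil_or_concat w with rfl | ⟨w₁, b, rfl⟩
          · simp at hlt
          · simp at hlt hl
            exact ⟨w₁, [b], by simp, by omega, Or.inr ⟨by omega, b, rfl⟩⟩
        · exact ⟨w, [], by simp, hge, Or.inl rfl⟩
      -- Both words are constant after time `u.length`, so only earlier times have to be compared.
      have hs₁ : SyncFellowTravel X K (u.map f) h (w₁.map f) := by
        intro t
        have hcap : ∀ t ≤ u.length, cayleyDist X ((u.map f).take t).prod
            (h * ((w₁.map f).take t).prod) ≤ K := by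
          intro t ht
          have := hs t
          rw [List.map_append, List.map_append, List.take_append_of_le_length (by simpa)] at this
          rcases hw₂ with rfl | ⟨hw₂, b, rfl⟩
          · simpa using this
          · rwa [List.take_append_of_le_length (by simpa [hw₂])] at this
        rcases le_total t u.length with ht | ht
        · exact hcap t ht
        · have := hcap u.length le_rfl
          rw [List.take_of_length_le (by simp), List.take_of_length_le (by simpa)] at this
          rwa [List.take_of_length_le (by simpa), List.take_of_length_le (by simp; omega)]
      have hmem : (L.leftQuotient w₁, (u.map f).prod⁻¹ * (h * (w₁.map f).prod),
          w₁.length < u.length) ∈ S u := ⟨w₁, h, hh, hw₁, hs₁, rfl⟩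
      rw [huv] at hmem
      obtain ⟨w', h', hh', hl', hs', heq⟩ := hmem
      simp only [Prod.mk.injEq] at heq
      obtain ⟨hq, hd, hlt⟩ := heq
      -- The recorded bit shows that, if a letter is to be appended, `w'` has not stopped either, so
      -- it reads the letter at the same time as `v`.
      have hw₂' : w₂ = [] ∨ w'.length = v.length ∧ ∃ b, w₂ = [b] := by
        rcases hw₂ with h | ⟨h, hb⟩
        · exact Or.inl h
        · refine Or.inr ⟨?_, hb⟩
          have : ¬ w'.length < v.length := by rw [← hlt]; omega
          omega
      have hd' : ((v ++ [a]).map f).prod⁻¹ * (h' * ((w' ++ w₂).map f).prod) =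
          ((u ++ [a]).map f).prod⁻¹ * (h * ((w₁ ++ w₂).map f).prod) := by
        simp only [List.map_append, List.prod_append, mul_inv_rev]
        rw [mul_assoc, mul_assoc, ← mul_assoc h', ← mul_assoc h, ← mul_assoc _ (h' * _),
          ← mul_assoc _ (h * _), hd]
      refine ⟨w' ++ w₂, h', hh', ?_, ?_, ?_⟩
      · rcases hw₂' with rfl | ⟨h, b, rfl⟩
        · simp; omega
        · simp; omega
      · intro t
        rcases le_or_gt t v.length with ht | ht
        · have := hs' t
          rw [List.map_append, List.map_append, List.take_append_of_le_length (by simpa)]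
          rcases hw₂' with rfl | ⟨hlen, b, rfl⟩
          · simpa using this
          · rwa [List.take_append_of_le_length (by simpa [hlen])]
        · rw [cayleyDist, List.take_of_length_le (by simp; omega), List.take_of_length_le, hd']
          · exact hlast
          · rcases hw₂' with rfl | ⟨h, b, rfl⟩
            · simp; omega
            · simp; omega
      · refine Prod.ext ?_ (Prod.ext hd'.symm ?_)
        · simp only [Language.leftQuotient_append, hq]
        · simp only [List.length_append, List.length_singleton, eq_iff_iff]
          rcases hw₂ with rfl | ⟨h, b, rfl⟩
          · simp; omega
          · rcases hw₂' with h0 | ⟨h', -⟩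
            · simp at h0
            · simp; omega
    obtain ⟨h₁, h₂⟩ := Prod.ext_iff.1 h
    exact Prod.ext (leftQuotient_snoc_congr a h₁)
      ((key u v h₂).antisymm (key v u h₂.symm))
  · intro u v h hu'
    obtain ⟨hu, w, hw, k, hk, he, hl, hs⟩ := hu'
    obtain ⟨h₁, h₂⟩ := Prod.ext_iff.1 h
    have hmem : (L.leftQuotient w, (u.map f).prod⁻¹ * (k * (w.map f).prod),
        w.length < u.length) ∈ S u := ⟨w, k, hk, hl.le, hs, rfl⟩
    simp only at h₂
    rw [h₂] at hmem
    obtain ⟨w', h', hh', hl', hs', heq⟩ := hmem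
    simp only [Prod.mk.injEq] at heq
    obtain ⟨hq, hd, hlt⟩ := heq
    refine ⟨(mem_iff_of_leftQuotient_eq h₁).1 hu, w', (mem_iff_of_leftQuotient_eq hq).1 hw, h',
      hh', ?_, hlt.mp hl, hs'⟩
    rw [← he, inv_mul_cancel] at hd
    rw [← inv_mul_eq_one, ← hd]

end Regular

end GOG

/-! ### Normal forms for multiple HNN extensions, by permutations of stacks -/

namespace GOG

/-- A group with partial isomorphisms `φ e` between subgroups `B e` and `B (bar e)`, the data of a
multiple HNN extension; `φ e` is a total function, whose values outside `B e` are irrelevant. -/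
structure HNNSystem (A E : Type*) [Group A] where
  bar : E → E
  B : E → Subgroup A
  φ : E → A → A
  bar_bar : ∀ e, bar (bar e) = e
  φ_mem : ∀ e, ∀ b ∈ B e, φ e b ∈ B (bar e)
  φ_mul : ∀ e, ∀ b ∈ B e, ∀ c ∈ B e, φ e (b * c) = φ e b * φ e c
  φ_φ : ∀ e, ∀ b ∈ B e, φ (bar e) (φ e b) = b

/-- A segment: an edge, or `none` for the first segment of a path, followed by a word. Paths are
lists of segments, the last segment first. -/
abbrev Seg (A E : Type*) := Option E × List A

/-- Two paths follow the same edges, and `g` can be moved from the right-hand end of the first path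
to its left-hand end, which turns the first path into the second. -/
inductive Matched {A E : Type*} [Group A] (B : E → Subgroup A) (φ : E → A → A) (B₀ : Subgroup A) :
    A → List (Seg A E) → List (Seg A E) → Prop
  | base (g : A) (z z' : List A) (h : z.prod * g * z'.prod⁻¹ ∈ B₀) :
      Matched B φ B₀ g [(none, z)] [(none, z')]
  | step (g : A) (e : E) (z z' : List A) (p p' : List (Seg A E))
      (h : z.prod * g * z'.prod⁻¹ ∈ B e)
      (hp : Matched B φ B₀ (φ e (z.prod * g * z'.prod⁻¹)) p p') :
      Matched B φ B₀ g ((some e, z) :: p) ((some e, z') :: p')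

namespace HNNSystem

variable {A E : Type*} [Group A] (S : HNNSystem A E)

theorem φ_bar_mem (e : E) {b : A} (hb : b ∈ S.B (S.bar e)) : S.φ (S.bar e) b ∈ S.B e := by
  have := S.φ_mem (S.bar e) b hb
  rwa [S.bar_bar] at this

theorem φ_φ_bar (e : E) {b : A} (hb : b ∈ S.B (S.bar e)) : S.φ e (S.φ (S.bar e) b) = b := by
  have := S.φ_φ (S.bar e) b hb
  rwa [S.bar_bar] at this

/-- The chosen representative of `g * B (bar e)`. -/
noncomputable def rep (e : E) (g : A) : A := (g : A ⧸ S.B (S.bar e)).out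

theorem rep_inv_mul_mem (e : E) (g : A) : (S.rep e g)⁻¹ * g ∈ S.B (S.bar e) :=
  QuotientGroup.eq.1 (Quotient.out_eq' (g : A ⧸ S.B (S.bar e)))

theorem rep_eq_of_mem (e : E) {g h : A} (hgh : g⁻¹ * h ∈ S.B (S.bar e)) :
    S.rep e g = S.rep e h := by
  unfold rep; rw [QuotientGroup.eq.2 hgh]

theorem rep_rep (e : E) (g : A) : S.rep e (S.rep e g) = S.rep e g :=
  S.rep_eq_of_mem e (S.rep_inv_mul_mem e g)

/-- A state: a group element, and a stack of coset representatives and stable letters. -/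
abbrev State (A E : Type*) := A × List (A × E)

/-- Multiplication by a stable letter that does not cancel. -/
noncomputable def push (e : E) (x : State A E) : State A E :=
  (S.φ (S.bar e) ((S.rep e x.1)⁻¹ * x.1), (S.rep e x.1, e) :: x.2)

open Classical in
/-- Multiplication by a stable letter. -/
noncomputable def act (e : E) : State A E → State A E
  | (g, []) => S.push e (g, [])
  | (g, (r, f) :: st) =>
    if e = S.bar f ∧ g ∈ S.B f then (r * S.φ f g, st) else S.push e (g, (r, f) :: st)

/-- Normal form of stacks. -/
def IsNormal : List (A × E) → Prop
  | [] => True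
  | (r, e) :: st => S.rep e r = r ∧ (∀ r' f st', st = (r', f) :: st' → e = S.bar f → r ∉ S.B f) ∧
      IsNormal st

theorem act_eq_push {e : E} {x : State A E}
    (h : ∀ r f st, x.2 = (r, f) :: st → e = S.bar f → x.1 ∉ S.B f) : S.act e x = S.push e x := by
  obtain ⟨g, st⟩ := x
  cases st with
  | nil => rfl
  | cons y st =>
    obtain ⟨r, f⟩ := y
    exact if_neg fun k => h r f st rfl k.1 k.2

theorem act_cancel {f : E} {g r : A} {st : List (A × E)} (hg : g ∈ S.B f) :
    S.act (S.bar f) (g, (r, f) :: st) = (r * S.φ f g, st) :=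
  if_pos ⟨rfl, hg⟩

theorem cancel_or (e : E) (x : State A E) :
    (∃ g r f st, x = (g, (r, f) :: st) ∧ e = S.bar f ∧ g ∈ S.B f) ∨
      ∀ r f st, x.2 = (r, f) :: st → e = S.bar f → x.1 ∉ S.B f := by
  by_cases h : ∃ g r f st, x = (g, (r, f) :: st) ∧ e = S.bar f ∧ g ∈ S.B f
  · exact Or.inl h
  · refine Or.inr fun r f st h₁ h₂ h₃ => h ⟨x.1, r, f, st, ?_, h₂, h₃⟩
    rw [← h₁]

theorem rep_mem_iff (e f : E) (g : A) (h : e = S.bar f) : S.rep e g ∈ S.B f ↔ g ∈ S.B f := by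
  have := S.rep_inv_mul_mem e g
  rw [h, S.bar_bar, ← h] at this
  constructor
  · intro h
    simpa using mul_mem h this
  · intro h
    exact (Subgroup.inv_mem_iff _).1 ((Subgroup.mul_mem_cancel_right _ h).1 this)

theorem isNormal_act (e : E) {x : State A E} (hx : S.IsNormal x.2) : S.IsNormal (S.act e x).2 := by
  rcases S.cancel_or e x with ⟨g, r, f, st, rfl, rfl, hg⟩ | h
  · rw [S.act_cancel hg]
    exact hx.2.2
  · rw [S.act_eq_push h]
    refine ⟨S.rep_rep _ _, fun r' f st' hst hf => ?_, hx⟩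
    rw [S.rep_mem_iff _ _ _ hf]
    exact h _ _ _ hst hf

/-- A cancellation undoes a push. Conversely a push undoes a cancellation because the stack is
normal: the coset representative taken from it is the chosen one, and the letter below it cannot
cancel. -/
theorem act_bar_act (e : E) {x : State A E} (hx : S.IsNormal x.2) :
    S.act (S.bar e) (S.act e x) = x := by
  rcases S.cancel_or e x with ⟨g, r, f, st, rfl, rfl, hg⟩ | h
  · have hb : S.φ f g ∈ S.B (S.bar f) := S.φ_mem _ _ hg
    rw [S.act_cancel hg, S.bar_bar, S.act_eq_push]
    · have hr : S.rep f (r * S.φ f g) = r := by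
        rw [← S.rep_eq_of_mem f (g := r) (by simpa using hb), hx.1]
      simp only [push, hr, inv_mul_cancel_left, S.φ_φ _ _ hg]
    · intro r' f' st' hst hf' hm
      refine hx.2.1 r' f' st' hst hf' ?_
      rw [hf', S.bar_bar] at hb
      rw [hf'] at hm
      exact (Subgroup.mul_mem_cancel_right _ hb).1 hm
  · rw [S.act_eq_push h]
    unfold push
    rw [S.act_cancel (S.φ_bar_mem e (S.rep_inv_mul_mem e _)),
      S.φ_φ_bar e (S.rep_inv_mul_mem e _), mul_inv_cancel_left]

/-- This becomes the relation `s_e b = φ_e(b) s_e`. The factor `φ_e(b)` lies in `B (bar e)`, so it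
affects neither the choice between push and cancellation nor the coset representative. -/
theorem act_mul (e : E) (x : State A E) {b : A} (hb : b ∈ S.B e) :
    S.act e (x.1 * S.φ e b, x.2) = ((S.act e x).1 * b, (S.act e x).2) := by
  have hφ := S.φ_mem e b hb
  rcases S.cancel_or e x with ⟨g, r, f, st, rfl, rfl, hg⟩ | h
  · have hφ' := S.φ_bar_mem f hb
    rw [S.act_cancel hg, S.act_cancel (mul_mem hg hφ'), S.φ_mul _ _ hg _ hφ', S.φ_φ_bar f hb,
      mul_assoc]
  · rw [S.act_eq_push h, S.act_eq_push]
    · have hr : S.rep e (x.1 * S.φ e b) = S.rep e x.1 :=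
        (S.rep_eq_of_mem e (by simpa using hφ)).symm
      simp only [push, hr]
      rw [← mul_assoc, S.φ_mul _ _ (S.rep_inv_mul_mem e _) _ hφ, S.φ_φ _ _ hb]
    · intro r f st hst hf hm
      refine h r f st hst hf ((Subgroup.mul_mem_cancel_right _ ?_).1 hm)
      rw [hf, S.bar_bar] at hφ
      rwa [hf]

/-- The states in normal form. -/
abbrev NormalState := {x : State A E // S.IsNormal x.2}

/-- A stable letter as a permutation of the states in normal form. -/
noncomputable def actPerm (e : E) : Equiv.Perm S.NormalState where
  toFun x := ⟨S.act e x.1, S.isNormal_act e x.2⟩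
  invFun x := ⟨S.act (S.bar e) x.1, S.isNormal_act _ x.2⟩
  left_inv x := Subtype.ext (S.act_bar_act e x.2)
  right_inv x := Subtype.ext (by
    have := S.act_bar_act (S.bar e) x.2
    rwa [S.bar_bar] at this)

/-- The group of right permutations of the states in normal form. -/
abbrev PermGroup := (Equiv.Perm S.NormalState)ᵐᵒᵖ

noncomputable def stable (e : E) : S.PermGroup := MulOpposite.op (S.actPerm e)

/-- Right multiplication by elements of `A`. -/
def right : A →* S.PermGroup where
  toFun a := MulOpposite.op
    { toFun := fun x => ⟨(x.1.1 * a, x.1.2), x.2⟩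
      invFun := fun x => ⟨(x.1.1 * a⁻¹, x.1.2), x.2⟩
      left_inv := fun x => by simp
      right_inv := fun x => by simp }
  map_one' := by
    apply MulOpposite.unop_injective
    ext x <;> simp
  map_mul' a b := by
    apply MulOpposite.unop_injective
    ext x <;> simp [mul_assoc]

theorem stable_bar (e : E) : S.stable (S.bar e) = (S.stable e)⁻¹ := by
  apply MulOpposite.unop_injective
  ext x <;> rfl

theorem stable_mul_right (e : E) {b : A} (hb : b ∈ S.B e) :
    S.stable e * S.right b = S.right (S.φ e b) * S.stable e := by
  apply MulOpposite.unop_injective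
  refine Equiv.ext fun x => Subtype.ext ?_
  exact (S.act_mul e x.1 hb).symm

/-- The permutation given by a path. -/
noncomputable def eval : List (Seg A E) → S.PermGroup
  | [] => 1
  | (none, z) :: _ => S.right z.prod
  | (some e, z) :: p => eval p * S.stable e * S.right z.prod

/-- Reduced paths. -/
def IsReduced : List (Seg A E) → Prop
  | [] => False
  | (none, _) :: p => p = []
  | (some e, _) :: p => (∀ f z q, p = (some f, z) :: q → e = S.bar f → z.prod ∉ S.B f) ∧ IsReduced p

/-- The state reached from `(h, [])` along a reduced path. -/
noncomputable def run (h : A) : List (Seg A E) → State A E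
  | [] => (h, [])
  | (none, z) :: _ => (h * z.prod, [])
  | (some e, z) :: p => ((S.push e (run h p)).1 * z.prod, (S.push e (run h p)).2)

/-- Along a reduced path every stable letter is pushed: after the edge `f` and the word `z` the
current element is an element of `B f` times `z.prod`, so cancellation would force `z.prod` into `B
f`. -/
theorem eval_apply (h : A) {p : List (Seg A E)} (hp : S.IsReduced p) :
    ((S.eval p).unop ⟨(h, []), trivial⟩).1 = S.run h p := by
  induction p with
  | nil => exact hp.elim
  | cons s p ih =>
    obtain ⟨i, z⟩ := s
    cases i with
    | none => rfl
    | some e =>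
      have hact : S.act e (S.run h p) = S.push e (S.run h p) := by
        refine S.act_eq_push fun r f st hst hf hm => ?_
        cases p with
        | nil => exact hp.2
        | cons s q =>
          obtain ⟨j, y⟩ := s
          cases j with
          | none => simp [run] at hst
          | some f' =>
            simp only [run, push, List.cons.injEq, Prod.mk.injEq] at hst
            obtain ⟨⟨rfl, rfl⟩, rfl⟩ := hst
            refine hp.1 f' y q rfl hf ?_
            refine (Subgroup.mul_mem_cancel_left _ ?_).1 hm
            exact S.φ_bar_mem _ (S.rep_inv_mul_mem _ _)
      have : ((S.eval ((some e, z) :: p)).unop ⟨(h, []), trivial⟩).1 =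
          ((S.act e ((S.eval p).unop ⟨(h, []), trivial⟩).1).1 * z.prod,
            (S.act e ((S.eval p).unop ⟨(h, []), trivial⟩).1).2) := rfl
      rw [this, ih hp.2, hact]
      rfl

/-- Equal stacks have the same edges and coset representatives. If the current elements before the
last edge are `r c` and `r c'`, then `z g z'⁻¹` is the image of `c⁻¹ c'` under `φ_{bar e}`, and `c⁻¹
c'` is the discrepancy between the shorter paths. -/
theorem matched_of_run {B₀ : Subgroup A} {h : A} (hh : h ∈ B₀) {p p' : List (Seg A E)}
    (hp : S.IsReduced p) (hp' : S.IsReduced p') {g : A}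
    (h₁ : (S.run 1 p).1 * g = (S.run h p').1) (h₂ : (S.run 1 p).2 = (S.run h p').2) :
    Matched S.B S.φ B₀ g p p' := by
  induction p generalizing p' g with
  | nil => exact hp.elim
  | cons s p ih =>
    obtain ⟨i, z⟩ := s
    cases p' with
    | nil => exact hp'.elim
    | cons s' p' =>
      obtain ⟨i', z'⟩ := s'
      cases i with
      | none =>
        cases i' with
        | none =>
          obtain rfl : p = [] := hp
          obtain rfl : p' = [] := hp'
          refine Matched.base _ _ _ ?_
          simp only [run, one_mul] at h₁
          rw [h₁, mul_inv_cancel_right]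
          exact hh
        | some f => simp [run, push] at h₂
      | some e =>
        cases i' with
        | none => simp [run, push] at h₂
        | some f =>
          simp only [run, push, List.cons.injEq, Prod.mk.injEq] at h₁ h₂
          obtain ⟨⟨hr, rfl⟩, hst⟩ := h₂
          have hc := S.rep_inv_mul_mem e (S.run 1 p).1
          have hc' := S.rep_inv_mul_mem e (S.run h p').1
          rw [← hr] at h₁ hc'
          set r := S.rep e (S.run 1 p).1
          set c := r⁻¹ * (S.run 1 p).1 with hcdef
          set c' := r⁻¹ * (S.run h p').1 with hcdef'
          have hb := S.φ_bar_mem e hc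
          have hb' := S.φ_bar_mem e hc'
          have hy : z.prod * g * z'.prod⁻¹ = (S.φ (S.bar e) c)⁻¹ * S.φ (S.bar e) c' := by
            rw [eq_inv_mul_iff_mul_eq, ← mul_assoc, ← mul_assoc, h₁, mul_inv_cancel_right]
          have hφ : S.φ e (z.prod * g * z'.prod⁻¹) = c⁻¹ * c' := by
            have := S.φ_mul e _ hb _ (mul_mem (inv_mem hb) hb')
            rw [mul_inv_cancel_left, S.φ_φ_bar e hc', S.φ_φ_bar e hc] at this
            rw [hy, eq_inv_mul_iff_mul_eq, ← this]
          refine Matched.step _ _ _ _ _ _ (by rw [hy]; exact mul_mem (inv_mem hb) hb') ?_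
          rw [hφ]
          refine ih hp.2 hp'.2 ?_ hst
          rw [hcdef, hcdef']
          group

theorem matched_of_eval {B₀ : Subgroup A} {h : A} (hh : h ∈ B₀) {p p' : List (Seg A E)}
    (hp : S.IsReduced p) (hp' : S.IsReduced p') {g : A}
    (heq : S.eval p * S.right g = S.right h * S.eval p') :
    Matched S.B S.φ B₀ g p p' := by
  have key : ((S.eval p * S.right g).unop ⟨(1, []), trivial⟩).1 =
      ((S.right h * S.eval p').unop ⟨(1, []), trivial⟩).1 := by rw [heq]
  have e₁ : ((S.eval p * S.right g).unop ⟨(1, []), trivial⟩).1 =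
      ((S.run 1 p).1 * g, (S.run 1 p).2) := by
    rw [← S.eval_apply 1 hp]; rfl
  have e₂ : ((S.right h * S.eval p').unop ⟨(1, []), trivial⟩).1 = S.run h p' := by
    rw [← S.eval_apply h hp']
    have : ((S.right h).unop ⟨(1, []), trivial⟩ : S.NormalState) = ⟨(h, []), trivial⟩ :=
      Subtype.ext (Prod.ext (one_mul h) rfl)
    rw [← this]; rfl
  rw [e₁, e₂] at key
  exact S.matched_of_run hh hp hp' (Prod.ext_iff.1 key).1 (Prod.ext_iff.1 key).2

end HNNSystem

end GOG

/-! ### Path words and reduced paths -/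

namespace GOG

/-- A graph of groups all of whose vertex groups lie in one group `A`, with generators and coset
languages, and a group `P` with homomorphisms `J v` defined on `A` and stable letters `s e`. -/
structure FlatGraph (V E A P : Type*) [Group A] [Group P] extends HNNSystem A E where
  ι : E → V
  τ : E → V
  X : V → Set A
  Y : E → Set A
  L : E → Language A
  J : V → A →* P
  s : E → P
  e₀ : E

/-- Letters of path words: a generator at a vertex, or an edge. -/
abbrev Letter (V E A : Type*) := (V × A) ⊕ E

namespace FlatGraph

variable {V E A P : Type*} [Group A] [Group P] (S : FlatGraph V E A P)

/-- The edge at whose terminal vertex a segment is read. -/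
def lab (i : Option E) : E := i.getD S.e₀

def vtx (i : Option E) : V := S.τ (S.lab i)

def terminal : List (Seg A E) → V
  | [] => S.τ S.e₀
  | (i, _) :: _ => S.vtx i

/-- The edge `e` may be appended to the path. -/
def Joinable (e : E) : List (Seg A E) → Prop
  | [] => False
  | (i, z) :: _ => S.ι e = S.vtx i ∧ ∀ f, i = some f → e = S.bar f → z ≠ []

/-- Reduced paths whose segments lie in the coset languages. -/
def IsLPath : List (Seg A E) → Prop
  | [] => False
  | (none, z) :: p => p = [] ∧ z ∈ S.L S.e₀
  | (some e, z) :: p => z ∈ S.L e ∧ S.Joinable e p ∧ IsLPath p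

/-- The word spelled by a path. -/
def flat : List (Seg A E) → List (Letter V E A)
  | [] => []
  | (none, z) :: _ => z.map fun x => Sum.inl (S.τ S.e₀, x)
  | (some e, z) :: p => flat p ++ Sum.inr e :: z.map fun x => Sum.inl (S.τ e, x)

/-- The group element of a letter. -/
def ev : Letter V E A → P
  | Sum.inl (v, x) => S.J v x
  | Sum.inr e => S.s e

def val (u : List (Letter V E A)) : P := (u.map S.ev).prod

/-- Words that spell a path from one vertex to another. -/
def IsPathWord : V → List (Letter V E A) → V → Prop
  | v, [], w => v = w
  | v, Sum.inl (u, x) :: l, w => u = v ∧ (x ∈ S.X v ∨ x⁻¹ ∈ S.X v) ∧ IsPathWord v l w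
  | v, Sum.inr e :: l, w => S.ι e = v ∧ IsPathWord (S.τ e) l w

/-- The generators of `P`. -/
def gens : Set P := {x | ∃ v, ∃ a ∈ S.X v, x = S.J v a} ∪ Set.range S.s

/-- The subgroup whose cosets are considered. -/
def base : Subgroup P := (S.B S.e₀).map (S.J (S.τ S.e₀))

/-- The word is shortest among the path words with the same end in the same coset. -/
def IsMin (a : V) (u : List (Letter V E A)) : Prop :=
  ∀ w, S.IsPathWord (S.τ S.e₀) w a → (∃ h ∈ S.base, S.val u = h * S.val w) → u.length ≤ w.length

/-- The hypotheses on a flat graph of groups. -/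
structure Good (Λ K : ℕ) : Prop where
  B_eq : ∀ e, S.B e = Subgroup.closure (S.Y e)
  ι_bar : ∀ e, S.ι (S.bar e) = S.τ e
  τ_bar : ∀ e, S.τ (S.bar e) = S.ι e
  Y_sub : ∀ e, S.Y e ⊆ S.X (S.τ e)
  word : ∀ e, ∀ z ∈ S.L e, IsWordOver (S.X (S.τ e)) z
  geo : ∀ e, ∀ z ∈ S.L e, ∀ t, IsWordOver (S.X (S.τ e)) t → t.prod = z.prod →
    z.length ≤ t.length
  dec : ∀ e, ∀ t, IsWordOver (S.X (S.τ e)) t → ∃ y z, IsWordOver (S.Y e) y ∧ z ∈ S.L e ∧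
    y.prod * z.prod = t.prod ∧ y.length + z.length ≤ t.length
  nil_mem : ∀ e, [] ∈ S.L e
  eq_nil : ∀ e, ∀ z ∈ S.L e, z.prod ∈ S.B e → z = []
  regular : ∀ e, (S.L e).IsRegular
  φ_word : ∀ e y, IsWordOver (S.Y e) y → ∃ y', IsWordOver (S.Y (S.bar e)) y' ∧
    y'.length ≤ y.length ∧ y'.prod = S.φ e y.prod
  one_le : 1 ≤ Λ
  cross : ∀ e f, S.τ e = S.τ f → ∀ u ∈ S.L e, ∀ v ∈ S.L e, ∀ g, wordLength (S.Y f) g ≤ Λ →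
    u.prod * g * v.prod⁻¹ ∈ S.B e → wordLength (S.Y e) (u.prod * g * v.prod⁻¹) ≤ Λ
  cross_one : ∀ e, ∀ u ∈ S.L e, ∀ v ∈ S.L e, ∀ g, wordLength (S.X (S.τ e)) g ≤ 1 →
    u.prod * g * v.prod⁻¹ ∈ S.B e → wordLength (S.Y e) (u.prod * g * v.prod⁻¹) ≤ Λ
  travel : ∀ e, ∀ u ∈ S.L e, ∀ v ∈ S.L e, ∀ h ∈ S.B e,
    cayleyDist (S.X (S.τ e)) u.prod (h * v.prod) ≤ Λ →
      SyncFellowTravel (S.X (S.τ e)) K u h v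
  s_bar : ∀ e, S.s (S.bar e) = (S.s e)⁻¹
  s_conj : ∀ e, ∀ b ∈ S.B e, S.s e * S.J (S.τ e) b = S.J (S.ι e) (S.φ e b) * S.s e
  nf : ∀ p p', S.IsLPath p → S.IsLPath p' → S.terminal p = S.terminal p' →
    ∀ g ∈ Subgroup.closure (S.X (S.terminal p)), ∀ b ∈ S.B S.e₀,
      S.val (S.flat p) * S.J (S.terminal p) g = S.J (S.τ S.e₀) b * S.val (S.flat p') →
        Matched S.B S.φ (S.B S.e₀) g p p'

section Basic

variable {S}

@[simp] theorem val_nil : S.val [] = 1 := rfl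

@[simp] theorem val_append (u v : List (Letter V E A)) : S.val (u ++ v) = S.val u * S.val v := by
  simp [val]

@[simp] theorem val_cons (c : Letter V E A) (v : List (Letter V E A)) :
    S.val (c :: v) = S.ev c * S.val v := by
  simp [val]

theorem val_map (v : V) (z : List A) : S.val (z.map fun x => Sum.inl (v, x)) = S.J v z.prod := by
  induction z with
  | nil => simp
  | cons x z ih => simp only [List.map_cons, val_cons, ih, List.prod_cons, map_mul]; rfl

theorem val_flat_none (z : List A) (p : List (Seg A E)) :
    S.val (S.flat ((none, z) :: p)) = S.J (S.τ S.e₀) z.prod := val_map _ _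

theorem val_flat_some (e : E) (z : List A) (p : List (Seg A E)) :
    S.val (S.flat ((some e, z) :: p)) = S.val (S.flat p) * S.s e * S.J (S.τ e) z.prod := by
  rw [flat, val_append, val_cons, val_map, mul_assoc]; rfl

theorem length_flat_none (z : List A) (p : List (Seg A E)) :
    (S.flat ((none, z) :: p)).length = z.length := by simp [flat]

theorem length_flat_some (e : E) (z : List A) (p : List (Seg A E)) :
    (S.flat ((some e, z) :: p)).length = (S.flat p).length + 1 + z.length := by
  simp [flat]; omega

theorem isPathWord_append {v w : V} {u₁ u₂ : List (Letter V E A)} :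
    S.IsPathWord v (u₁ ++ u₂) w ↔ ∃ m, S.IsPathWord v u₁ m ∧ S.IsPathWord m u₂ w := by
  induction u₁ generalizing v with
  | nil => simp [IsPathWord]
  | cons c u₁ ih =>
    rcases c with ⟨a, x⟩ | e
    · simp only [List.cons_append, IsPathWord, ih]
      constructor
      · rintro ⟨h₁, h₂, m, h₃, h₄⟩
        exact ⟨m, ⟨h₁, h₂, h₃⟩, h₄⟩
      · rintro ⟨m, ⟨h₁, h₂, h₃⟩, h₄⟩
        exact ⟨h₁, h₂, m, h₃, h₄⟩
    · simp only [List.cons_append, IsPathWord, ih]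
      constructor
      · rintro ⟨h₁, m, h₃, h₄⟩
        exact ⟨m, ⟨h₁, h₃⟩, h₄⟩
      · rintro ⟨m, ⟨h₁, h₃⟩, h₄⟩
        exact ⟨h₁, m, h₃, h₄⟩

theorem IsPathWord.unique {v w w' : V} {u : List (Letter V E A)} (h : S.IsPathWord v u w)
    (h' : S.IsPathWord v u w') : w = w' := by
  induction u generalizing v with
  | nil => exact h.symm.trans h'
  | cons c u ih =>
    rcases c with ⟨a, x⟩ | e
    · exact ih h.2.2 h'.2.2
    · exact ih h.2 h'.2

theorem isPathWord_map {v : V} {z : List A} (hz : IsWordOver (S.X v) z) :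
    S.IsPathWord v (z.map fun x => Sum.inl (v, x)) v := by
  induction z with
  | nil => rfl
  | cons x z ih => exact ⟨rfl, hz x (by simp), ih fun y hy => hz y (by simp [hy])⟩

theorem isWordOver_map_ev {v w : V} {u : List (Letter V E A)} (h : S.IsPathWord v u w) :
    IsWordOver S.gens (u.map S.ev) := by
  induction u generalizing v with
  | nil => exact IsWordOver.nil
  | cons c u ih =>
    rcases c with ⟨a, x⟩ | e
    · obtain ⟨rfl, hx, h⟩ := h
      intro y hy
      rcases List.mem_cons.1 hy with rfl | hy
      · refine hx.imp (fun h => Or.inl ⟨a, x, h, rfl⟩) fun h => Or.inl ⟨a, x⁻¹, h, ?_⟩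
        simp [ev]
      · exact ih h y hy
    · intro y hy
      rcases List.mem_cons.1 hy with rfl | hy
      · exact Or.inl (Or.inr ⟨e, rfl⟩)
      · exact ih h.2 y hy

theorem Joinable.ι_eq {e : E} {p : List (Seg A E)} (h : S.Joinable e p) : S.ι e = S.terminal p := by
  cases p with
  | nil => exact h.elim
  | cons s p => exact h.1

end Basic

/-! ### Shortest path words in a coset -/

section Paths

variable {S} {Λ K : ℕ} (hS : S.Good Λ K)
include hS

theorem isPathWord_flat {p : List (Seg A E)} (hp : S.IsLPath p) :
    S.IsPathWord (S.τ S.e₀) (S.flat p) (S.terminal p) := by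
  induction p with
  | nil => exact hp.elim
  | cons s p ih =>
    obtain ⟨i, z⟩ := s
    cases i with
    | none => exact isPathWord_map (hS.word _ _ hp.2)
    | some e =>
      obtain ⟨hz, hj, hp⟩ := hp
      exact isPathWord_append.2 ⟨_, ih hp, hj.ι_eq, isPathWord_map (hS.word _ _ hz)⟩

theorem J_mem_base {y : List A} (hy : IsWordOver (S.Y S.e₀) y) :
    S.J (S.τ S.e₀) y.prod ∈ S.base :=
  ⟨y.prod, by rw [hS.B_eq]; exact hy.prod_mem, rfl⟩

/-- The last segment times `t` is rewritten as `y z'`; `y` crosses the edge as a word of no greater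
length over the generators of the previous vertex, where the argument repeats. What leaves the first
segment lies in `base`. The clause on `Joinable` serves the induction: moving `y` to the left must
not create a backtrack. -/
theorem exists_mul_right {p : List (Seg A E)} (hp : S.IsLPath p) {t : List A}
    (ht : IsWordOver (S.X (S.terminal p)) t) :
    ∃ p', S.IsLPath p' ∧ S.terminal p' = S.terminal p ∧
      (∀ e, t.prod ∈ S.B (S.bar e) → S.Joinable e p → S.Joinable e p') ∧
      (S.flat p').length ≤ (S.flat p).length + t.length ∧
      ∃ h ∈ S.base, S.val (S.flat p) * S.J (S.terminal p) t.prod = h * S.val (S.flat p') := by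
  induction p generalizing t with
  | nil => exact hp.elim
  | cons s p ih =>
    obtain ⟨i, z⟩ := s
    cases i with
    | none =>
      obtain ⟨rfl, hz⟩ := hp
      obtain ⟨y, z', hy, hz', hyz, hl⟩ := hS.dec S.e₀ (z ++ t) ((hS.word _ _ hz).append ht)
      refine ⟨[(none, z')], ⟨rfl, hz'⟩, rfl, fun e _ hj => ⟨hj.1, fun f hf => by simp at hf⟩, ?_,
        _, J_mem_base hS hy, ?_⟩
      · rw [length_flat_none, length_flat_none]
        simp at hl; omega
      · rw [val_flat_none, val_flat_none, ← map_mul, hyz, List.prod_append, map_mul]; rfl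
    | some f =>
      obtain ⟨hz, hj, hp⟩ := hp
      obtain ⟨y, z', hy, hz', hyz, hl⟩ := hS.dec f (z ++ t) ((hS.word _ _ hz).append ht)
      obtain ⟨y', hy', hyl, hyp⟩ := hS.φ_word f y hy
      have hyX : IsWordOver (S.X (S.terminal p)) y' := by
        rw [← hj.ι_eq, ← hS.τ_bar]; exact hy'.mono (hS.Y_sub _)
      have hyB : y.prod ∈ S.B f := by rw [hS.B_eq]; exact hy.prod_mem
      obtain ⟨p', hp', hter, hjoin, hlen, h, hh, hval⟩ := ih hp hyX
      refine ⟨(some f, z') :: p', ⟨hz', hjoin f ?_ hj, hp'⟩, rfl, ?_, ?_, h, hh, ?_⟩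
      · rw [hS.B_eq]; exact hy'.prod_mem
      -- If the new segment were empty at a possible backtrack, then `z.prod` would lie in `B f`, so
      -- `z` would be empty and the backtrack would have been there before.
      · rintro e hte ⟨hι, hne⟩
        refine ⟨hι, ?_⟩
        rintro f' hf' rfl rfl
        obtain rfl : f = f' := Option.some_injective _ hf'
        refine hne f rfl rfl (hS.eq_nil f z hz ?_)
        rw [S.bar_bar] at hte
        rw [List.prod_nil, mul_one, List.prod_append] at hyz
        rw [hyz] at hyB
        exact (Subgroup.mul_mem_cancel_right _ hte).1 hyB
      · rw [length_flat_some, length_flat_some]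
        simp at hl; omega
      · have e₁ : S.J (S.τ f) z.prod * S.J (S.τ f) t.prod =
            S.J (S.τ f) y.prod * S.J (S.τ f) z'.prod := by
          rw [← map_mul, ← map_mul, hyz, List.prod_append]
        rw [val_flat_some, val_flat_some]
        change _ * S.J (S.τ f) t.prod = _
        rw [mul_assoc _ (S.J _ z.prod), e₁, ← mul_assoc, mul_assoc _ (S.s f),
          hS.s_conj _ _ hyB, hj.ι_eq, ← hyp, ← mul_assoc, hval]
        group

/-- Letters are absorbed one at a time: a generator by `exists_mul_right`, and an edge either
extends the path or cancels its last edge. Hence a shortest word of a coset may be taken to spell a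
reduced path. -/
theorem exists_isLPath {u : List (Letter V E A)} {a : V} (hu : S.IsPathWord (S.τ S.e₀) u a) :
    ∃ p, S.IsLPath p ∧ S.terminal p = a ∧ (S.flat p).length ≤ u.length ∧
      ∃ h ∈ S.base, S.val u = h * S.val (S.flat p) := by
  induction u using List.reverseRecOn generalizing a with
  | nil =>
    exact ⟨[(none, [])], ⟨rfl, hS.nil_mem _⟩, hu, by simp [flat], 1, one_mem _, by simp [flat]⟩
  | append_singleton u c ih =>
    obtain ⟨b, hb, hc⟩ := isPathWord_append.1 hu
    obtain ⟨p, hp, rfl, hlen, h, hh, hval⟩ := ih hb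
    rcases c with ⟨v, x⟩ | e
    · obtain ⟨rfl, hx, rfl⟩ := hc
      have hxw : IsWordOver (S.X (S.terminal p)) [x] := by
        intro y hy
        obtain rfl : y = x := by simpa using hy
        exact hx
      obtain ⟨p', hp', hter, -, hlen', h', hh', hval'⟩ := exists_mul_right hS hp hxw
      refine ⟨p', hp', hter, ?_, h * h', mul_mem hh hh', ?_⟩
      · simp at hlen' ⊢; omega
      · rw [mul_assoc, ← hval', val_append, hval, val_cons, val_nil]
        simp [ev, mul_assoc]
    · obtain ⟨hι, rfl⟩ := hc
      by_cases hj : S.Joinable e p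
      · refine ⟨(some e, []) :: p, ⟨hS.nil_mem e, hj, hp⟩, rfl, ?_, h, hh, ?_⟩
        · rw [length_flat_some]; simpa using hlen
        · rw [val_flat_some, val_append, hval]; simp [ev, mul_assoc]
      · cases p with
        | nil => exact hp.elim
        | cons s q =>
          obtain ⟨i, z⟩ := s
          obtain ⟨f, rfl, rfl, rfl⟩ : ∃ f, i = some f ∧ e = S.bar f ∧ z = [] := by
            by_contra! hcon
            exact hj ⟨hι, fun f h₁ h₂ => hcon f h₁ h₂⟩
          obtain ⟨-, hjq, hq⟩ := hp
          refine ⟨q, hq, ?_, ?_, h, hh, ?_⟩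
          · rw [hS.τ_bar, hjq.ι_eq]
          · rw [length_flat_some] at hlen; simp; omega
          · rw [val_append, hval, val_flat_some]; simp [ev, hS.s_bar, mul_assoc]

theorem exists_isMin {u : List (Letter V E A)} {a : V} (hu : S.IsPathWord (S.τ S.e₀) u a) :
    ∃ p, S.IsLPath p ∧ S.terminal p = a ∧ S.IsMin a (S.flat p) ∧
      ∃ h ∈ S.base, S.val u = h * S.val (S.flat p) := by
  classical
  have hex : ∃ n, ∃ w : List (Letter V E A), w.length = n ∧ S.IsPathWord (S.τ S.e₀) w a ∧
      ∃ h ∈ S.base, S.val u = h * S.val w := ⟨_, u, rfl, hu, 1, one_mem _, by simp⟩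
  obtain ⟨w, hwl, hw, h, hh, hval⟩ := Nat.find_spec hex
  obtain ⟨p, hp, rfl, hlen, h', hh', hval'⟩ := exists_isLPath hS hw
  have e₁ : S.val u = h * h' * S.val (S.flat p) := by rw [hval, hval', mul_assoc]
  refine ⟨p, hp, rfl, ?_, h * h', mul_mem hh hh', e₁⟩
  rintro w' hw' ⟨k, hk, hval''⟩
  have := Nat.find_min' hex ⟨w', rfl, hw', h * h' * k, mul_mem (mul_mem hh hh') hk, by
    rw [mul_assoc, ← hval'', e₁]⟩
  omega

omit hS in
theorem IsMin.of_append {u x : List (Letter V E A)} {a b : V} (hx : S.IsPathWord b x a)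
    (h : S.IsMin a (u ++ x)) : S.IsMin b u := by
  rintro w hw ⟨k, hk, hval⟩
  have := h (w ++ x) (isPathWord_append.2 ⟨b, hw, hx⟩)
    ⟨k, hk, by rw [val_append, val_append, hval, mul_assoc]⟩
  simpa using this

/-- All the initial subpaths that end with a segment are minimal. -/
def NodesMin (S : FlatGraph V E A P) : List (Seg A E) → Prop
  | [] => True
  | s :: p => S.IsMin (S.terminal (s :: p)) (S.flat (s :: p)) ∧ NodesMin S p

theorem NodesMin.of_isMin {p : List (Seg A E)} (hp : S.IsLPath p)
    (h : S.IsMin (S.terminal p) (S.flat p)) : NodesMin S p := by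
  induction p with
  | nil => trivial
  | cons s p ih =>
    refine ⟨h, ?_⟩
    obtain ⟨i, z⟩ := s
    cases i with
    | none => rw [hp.1]; trivial
    | some e =>
      obtain ⟨hz, hj, hp⟩ := hp
      refine ih hp (IsMin.of_append (S := S) (a := S.τ e) ?_ h)
      exact ⟨hj.ι_eq, isPathWord_map (hS.word _ _ hz)⟩

omit hS in
theorem length_le_of_isMin {p p' : List (Seg A E)} (hp' : S.IsPathWord (S.τ S.e₀) (S.flat p')
    (S.terminal p)) (hm : S.IsMin (S.terminal p) (S.flat p)) {g : A} {n : ℕ}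
    (hg : wordLength (S.X (S.terminal p)) g ≤ n) {h : P} (hh : h ∈ S.base)
    (hval : S.val (S.flat p) = h * (S.val (S.flat p') * S.J (S.terminal p) g)) :
    (S.flat p).length ≤ (S.flat p').length + n := by
  obtain ⟨t, ht, rfl, htn⟩ := (wordLength_le_iff _ _ _).1 hg
  have := hm (S.flat p' ++ t.map fun x => Sum.inl (S.terminal p, x))
    (isPathWord_append.2 ⟨_, hp', isPathWord_map ht⟩)
    ⟨h, hh, by rw [val_append, val_map, hval]⟩
  simp at this; omega

/-- Each minimal word, prolonged by a word for `g` or `g⁻¹`, competes with the other. This bounds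
the time lag at the ends of segments. -/
theorem length_flat_close {p p' : List (Seg A E)} (hp : S.IsLPath p) (hp' : S.IsLPath p')
    (hter : S.terminal p = S.terminal p') (hm : S.IsMin (S.terminal p) (S.flat p))
    (hm' : S.IsMin (S.terminal p') (S.flat p')) {g : A} {n : ℕ}
    (hg : wordLength (S.X (S.terminal p)) g ≤ n) {h : P} (hh : h ∈ S.base)
    (hval : S.val (S.flat p) * S.J (S.terminal p) g = h * S.val (S.flat p')) :
    (S.flat p).length ≤ (S.flat p').length + n ∧ (S.flat p').length ≤ (S.flat p).length + n := by
  constructor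
  · refine length_le_of_isMin (by rw [hter]; exact isPathWord_flat hS hp') hm
      (wordLength_inv_le hg) hh ?_
    rw [← mul_assoc, ← hval, map_inv, mul_inv_cancel_right]
  · refine length_le_of_isMin (by rw [← hter]; exact isPathWord_flat hS hp) hm'
      (by rw [← hter]; exact hg) (inv_mem hh) ?_
    rw [← hter, hval, inv_mul_cancel_left]

/-- The element `g` is moved across a segment at the vertex `v`. -/
def IsShort (S : FlatGraph V E A P) (Λ : ℕ) (v : V) (g : A) : Prop :=
  wordLength (S.X v) g ≤ 1 ∨ ∃ f, S.τ f = v ∧ wordLength (S.Y f) g ≤ Λ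

theorem IsShort.wordLength_le {v : V} {g : A} (h : IsShort S Λ v g) :
    wordLength (S.X v) g ≤ Λ := by
  rcases h with h | ⟨f, rfl, h⟩
  · exact wordLength_le_of_le (m := 1) (by simpa using h) hS.one_le
  · exact wordLength_anti (hS.Y_sub f) h

theorem IsShort.cross {e : E} {u v : List A} {g : A} (h : IsShort S Λ (S.τ e) g) (hu : u ∈ S.L e)
    (hv : v ∈ S.L e) (hm : u.prod * g * v.prod⁻¹ ∈ S.B e) :
    wordLength (S.Y e) (u.prod * g * v.prod⁻¹) ≤ Λ := by
  rcases h with h | ⟨f, hf, h⟩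
  · exact hS.cross_one e u hu v hv g h hm
  · exact hS.cross e f hf.symm u hu v hv g h hm

theorem segment_travel {e : E} {u v : List A} {g : A} (h : IsShort S Λ (S.τ e) g) (hu : u ∈ S.L e)
    (hv : v ∈ S.L e) (hm : u.prod * g * v.prod⁻¹ ∈ S.B e) :
    SyncFellowTravel (S.X (S.τ e)) K u (u.prod * g * v.prod⁻¹) v := by
  refine hS.travel e u hu v hv _ hm ?_
  have := h.wordLength_le hS
  rwa [cayleyDist, inv_mul_cancel_right, inv_mul_cancel_left]

/-- `u` is geodesic and equals `y v g⁻¹`, where `y` and `g` have length at most Λ; symmetrically for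
`v`. -/
theorem segment_length {e : E} {u v : List A} {g : A} (h : IsShort S Λ (S.τ e) g) (hu : u ∈ S.L e)
    (hv : v ∈ S.L e) (hm : u.prod * g * v.prod⁻¹ ∈ S.B e) :
    u.length ≤ v.length + 2 * Λ ∧ v.length ≤ u.length + 2 * Λ := by
  obtain ⟨t, ht, hgt, htn⟩ := (wordLength_le_iff _ _ _).1 (h.wordLength_le hS)
  obtain ⟨t', ht', hgt', htn'⟩ := (wordLength_le_iff _ _ _).1
    (wordLength_inv_le (h.wordLength_le hS))
  have hy := wordLength_anti (hS.Y_sub e) (h.cross hS hu hv hm)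
  obtain ⟨y, hy₁, hyp, hyn⟩ := (wordLength_le_iff _ _ _).1 hy
  obtain ⟨y', hy₁', hyp', hyn'⟩ := (wordLength_le_iff _ _ _).1 (wordLength_inv_le hy)
  have h₁ := hS.geo e u hu (y ++ v ++ t') ((hy₁.append (hS.word _ _ hv)).append ht')
    (by simp only [List.prod_append, hyp, hgt']; group)
  have h₂ := hS.geo e v hv (y' ++ u ++ t) ((hy₁'.append (hS.word _ _ hu)).append ht)
    (by simp only [List.prod_append, hyp', hgt]; group)
  simp at h₁ h₂
  omega

end Paths

end FlatGraph

end GOG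

namespace GOG

namespace FlatGraph

variable {V E A P : Type*} [Group A] [Group P] {S : FlatGraph V E A P}

/-! ### Synchronous fellow travelling of minimal paths -/

section Travel

variable {Λ K : ℕ} (hS : S.Good Λ K)

theorem wordLength_J_le {v : V} {g : A} {n : ℕ} (hg : wordLength (S.X v) g ≤ n) :
    wordLength S.gens (S.J v g) ≤ n :=
  wordLength_map_le (S.J v) (fun x hx => Or.inl ⟨v, x, hx, rfl⟩) hg

theorem prod_take_map (v : V) (z : List A) (t : ℕ) :
    (((z.map fun x => (Sum.inl (v, x) : Letter V E A)).map S.ev).take t).prod =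
      S.J v (z.take t).prod := by
  rw [← List.map_take, ← List.map_take]
  exact val_map _ _

theorem prod_take_flat_of_le {e : E} {z : List A} {p : List (Seg A E)} {t : ℕ}
    (ht : t ≤ (S.flat p).length) :
    (((S.flat ((some e, z) :: p)).map S.ev).take t).prod =
      (((S.flat p).map S.ev).take t).prod := by
  rw [flat, List.map_append, List.take_append_of_le_length (by simpa)]

theorem prod_take_flat_add {e : E} {z : List A} {p : List (Seg A E)} (j : ℕ) :
    (((S.flat ((some e, z) :: p)).map S.ev).take ((S.flat p).length + 1 + j)).prod =
      S.val (S.flat p) * S.s e * S.J (S.τ e) (z.take j).prod := by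
  rw [flat, List.map_append, List.take_append, List.prod_append,
    List.take_of_length_le (by simp; omega)]
  have : (S.flat p).length + 1 + j - ((S.flat p).map S.ev).length = j + 1 := by simp; omega
  rw [this, List.map_cons, List.take_succ_cons, List.prod_cons, prod_take_map, mul_assoc]
  rfl

omit [Group A] in
theorem take_min_length (z : List A) (j : ℕ) : z.take (min j z.length) = z.take j := by
  rw [List.take_eq_take_iff]; omega

include hS

theorem segment_cayleyDist {e : E} {u v : List A} {g : A} (h : IsShort S Λ (S.τ e) g)
    (hu : u ∈ S.L e) (hv : v ∈ S.L e) (hm : u.prod * g * v.prod⁻¹ ∈ S.B e) (j : ℕ) :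
    cayleyDist S.gens (S.J (S.τ e) (u.take j).prod)
      (S.J (S.τ e) (u.prod * g * v.prod⁻¹) * S.J (S.τ e) (v.take (min j v.length)).prod) ≤ K := by
  rw [cayleyDist, ← map_mul, ← map_inv, ← map_mul, take_min_length]
  exact wordLength_J_le (segment_travel hS h hu hv hm j)

/-- Crossover turns a short discrepancy into one of length at most Λ over `Y e`, and stability hands
it to the previous segment at the same length, so all pairs of segments fellow travel. The lag `3 *
Λ` consists of Λ at the start of a segment, by minimality, and `2 * Λ` inside it. Minimality is
asked only of proper initial subpaths, so that the result also applies to a path that first fails to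
be minimal at its end. -/
theorem travel_of_matched {p p' : List (Seg A E)} {g : A} (hM : Matched S.B S.φ (S.B S.e₀) g p p')
    (hp : S.IsLPath p) (hp' : S.IsLPath p') (hg : IsShort S Λ (S.terminal p) g)
    (hn : NodesMin S p.tail) (hn' : NodesMin S p'.tail) {h : P} (hh : h ∈ S.base)
    (hval : S.val (S.flat p) * S.J (S.terminal p) g = h * S.val (S.flat p')) :
    S.terminal p = S.terminal p' ∧ (S.flat p').length ≤ (S.flat p).length + 3 * Λ ∧
    ∀ t ≤ (S.flat p).length, ∃ t' ≤ (S.flat p').length, t ≤ t' + 3 * Λ ∧ t' ≤ t + 3 * Λ ∧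
      cayleyDist S.gens (((S.flat p).map S.ev).take t).prod
        (h * (((S.flat p').map S.ev).take t').prod) ≤ K := by
  induction hM with
  | base g z z' hy =>
    have hlen := segment_length hS hg hp.2 hp'.2 hy
    have hheq : h = S.J (S.τ S.e₀) (z.prod * g * z'.prod⁻¹) := by
      rw [val_flat_none, val_flat_none] at hval
      rw [map_mul, map_mul, map_inv, eq_mul_inv_iff_mul_eq, ← hval]; rfl
    refine ⟨rfl, by rw [length_flat_none, length_flat_none]; omega, fun t ht => ?_⟩
    rw [length_flat_none] at ht
    -- The cap keeps the second traveller at the end of its segment if that segment is the shorter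
    -- one.
    refine ⟨min t z'.length, by rw [length_flat_none]; omega, by omega, by omega, ?_⟩
    have := segment_cayleyDist hS hg hp.2 hp'.2 hy t
    change cayleyDist S.gens (S.J (S.τ S.e₀) _) (S.J (S.τ S.e₀) _ * S.J (S.τ S.e₀) _) ≤ _ at this
    rw [← hheq] at this
    simpa only [flat, prod_take_map] using this
  | step g e z z' p p' hy hM ih =>
    obtain ⟨hz, hj, hp⟩ := hp
    obtain ⟨hz', hj', hp'⟩ := hp'
    have hlen := segment_length hS hg hz hz' hy
    set y := z.prod * g * z'.prod⁻¹ with hydef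
    have hshort : IsShort S Λ (S.terminal p) (S.φ e y) := by
      refine Or.inr ⟨S.bar e, by rw [hS.τ_bar, hj.ι_eq], ?_⟩
      obtain ⟨w, hw, hwy, hwn⟩ := (wordLength_le_iff _ _ _).1 (hg.cross hS hz hz' hy)
      obtain ⟨w', hw', hl, hwp⟩ := hS.φ_word e w hw
      refine (wordLength_le_iff _ _ _).2 ⟨w', hw', ?_, hl.trans hwn⟩
      rw [hwp, hwy]
    have hter : S.terminal p = S.terminal p' := by rw [← hj.ι_eq, hj'.ι_eq]
    have hvalp : S.val (S.flat p) * S.J (S.terminal p) (S.φ e y) = h * S.val (S.flat p') := by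
      rw [val_flat_some, val_flat_some] at hval
      have e₁ : S.J (S.τ e) z.prod * S.J (S.τ e) g = S.J (S.τ e) y * S.J (S.τ e) z'.prod := by
        rw [← map_mul, ← map_mul, hydef]; group
      have e₂ : S.val (S.flat p) * S.s e * (S.J (S.τ e) y * S.J (S.τ e) z'.prod) =
          h * S.val (S.flat p') * S.s e * S.J (S.τ e) z'.prod := by
        rw [← e₁, ← mul_assoc]
        change _ * S.J (S.τ e) g = _ at hval
        rw [hval]; group
      rw [← mul_assoc] at e₂
      have e₃ := mul_right_cancel e₂
      rw [mul_assoc, hS.s_conj e y hy, ← mul_assoc, hj.ι_eq] at e₃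
      exact mul_right_cancel e₃
    have hpt : S.IsMin (S.terminal p) (S.flat p) ∧ NodesMin S p.tail := by
      cases p with
      | nil => exact hp.elim
      | cons s p => exact hn
    have hpt' : S.IsMin (S.terminal p') (S.flat p') ∧ NodesMin S p'.tail := by
      cases p' with
      | nil => exact hp'.elim
      | cons s p' => exact hn'
    obtain ⟨-, hl, htr⟩ := ih hp hp' hshort hpt.2 hpt'.2 hvalp
    have hclose := length_flat_close hS hp hp' hter hpt.1 hpt'.1 (hshort.wordLength_le hS) hh hvalp
    refine ⟨rfl, ?_, fun t ht => ?_⟩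
    · rw [length_flat_some, length_flat_some]; omega
    · rcases Nat.lt_or_ge (S.flat p).length t with hlt | hge
      · obtain ⟨j, rfl⟩ : ∃ j, t = (S.flat p).length + 1 + j := ⟨t - (S.flat p).length - 1, by omega⟩
        rw [length_flat_some] at ht
        refine ⟨(S.flat p').length + 1 + min j z'.length, by rw [length_flat_some]; omega,
          by omega, by omega, ?_⟩
        rw [prod_take_flat_add, prod_take_flat_add]
        have e₁ : h * (S.val (S.flat p') * S.s e * S.J (S.τ e) (z'.take (min j z'.length)).prod) =
            S.val (S.flat p) * S.s e *
              (S.J (S.τ e) y * S.J (S.τ e) (z'.take (min j z'.length)).prod) := by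
          rw [← mul_assoc, ← mul_assoc, ← hvalp, ← mul_assoc, mul_assoc _ (S.s e) (S.J _ y),
            hS.s_conj e y hy, hj.ι_eq]
          group
        rw [e₁, cayleyDist_mul_left]
        exact segment_cayleyDist hS hg hz hz' hy j
      · obtain ⟨t', ht', h₁, h₂, h₃⟩ := htr t hge
        refine ⟨t', by rw [length_flat_some]; omega, h₁, h₂, ?_⟩
        rw [prod_take_flat_of_le hge, prod_take_flat_of_le ht']
        exact h₃

/-- Removing the lag costs `3 * Λ` on top of `K`. After the end of the first word the end points
differ by `g` and the bound is `1 + 3 * Λ ≤ 4 * Λ`. -/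
theorem syncFellowTravel_of_nodesMin {p p' : List (Seg A E)} (hp : S.IsLPath p)
    (hp' : S.IsLPath p') (hter : S.terminal p = S.terminal p') {g : A}
    (hg : wordLength (S.X (S.terminal p)) g ≤ 1)
    (hn : NodesMin S p.tail) (hn' : NodesMin S p'.tail) {h : P} (hh : h ∈ S.base)
    (hval : S.val (S.flat p) * S.J (S.terminal p) g = h * S.val (S.flat p')) :
    SyncFellowTravel S.gens (K + 4 * Λ) ((S.flat p).map S.ev) h ((S.flat p').map S.ev) := by
  obtain ⟨b, hb, rfl⟩ := hh
  have hg' : wordLength (S.X (S.terminal p)) g ≤ (1 : ℕ) := by simpa using hg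
  have hM := hS.nf p p' hp hp' hter g (mem_closure_of_wordLength_le hg') b hb hval
  obtain ⟨-, hlen, htr⟩ := travel_of_matched hS hM hp hp' (Or.inl hg) hn hn' ⟨b, hb, rfl⟩ hval
  have hw := isWordOver_map_ev (isPathWord_flat hS hp')
  intro t
  rcases le_or_gt t (S.flat p).length with ht | ht
  · obtain ⟨t', -, h₁, h₂, h₃⟩ := htr t ht
    refine wordLength_le_of_le (cayleyDist_triangle h₃ (n := 3 * Λ) ?_) (by omega)
    rw [cayleyDist_mul_left]
    exact cayleyDist_take_le hw (by omega) (by omega)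
  · rw [List.take_of_length_le (by simp; omega)]
    have h₁ : cayleyDist S.gens ((S.flat p).map S.ev).prod
        (S.J (S.τ S.e₀) b * ((S.flat p').map S.ev).prod) ≤ (1 : ℕ) := by
      change cayleyDist S.gens (S.val _) (_ * S.val _) ≤ _
      rw [cayleyDist, ← hval, inv_mul_cancel_left]
      exact wordLength_J_le hg'
    refine wordLength_le_of_le (cayleyDist_triangle h₁ (n := 3 * Λ) ?_)
      (by have := hS.one_le; omega)
    rw [cayleyDist_mul_left]
    rcases le_or_gt (S.flat p').length t with h₂ | h₂
    · rw [List.take_of_length_le (by simpa)]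
      rw [cayleyDist, inv_mul_cancel]
      exact wordLength_one_le _
    · have := cayleyDist_take_le hw (s := (S.flat p').length) (t := t) (n := 3 * Λ)
        (by omega) (by omega)
      rwa [List.take_of_length_le (l := (S.flat p').map S.ev) (by simp)] at this

omit hS in
theorem syncFellowTravel_take {u v : List P} (hv : IsWordOver S.gens (u ++ v)) (hl : v.length ≤ 1) :
    SyncFellowTravel S.gens 1 u 1 (u ++ v) := by
  intro t
  rw [one_mul]
  rcases le_or_gt t u.length with ht | ht
  · rw [List.take_append_of_le_length ht, cayleyDist, inv_mul_cancel]
    exact wordLength_one_le _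
  · rw [List.take_of_length_le ht.le, List.take_of_length_le (by simp; omega), List.prod_append,
      cayleyDist, inv_mul_cancel_left]
    refine wordLength_le_of_le (IsWordOver.wordLength_le fun x hx => hv x (by simp [hx])) hl

/-- A vertex letter is a discrepancy of length 1. An edge letter is appended to the path or cancels
its last edge; the new path differs from `p` by one letter, which accounts for the extra 1, and its
proper initial subpaths are still minimal. -/
theorem syncFellowTravel_step {p p' : List (Seg A E)} (hp : S.IsLPath p) (hp' : S.IsLPath p')
    (hm : S.IsMin (S.terminal p) (S.flat p)) (hm' : S.IsMin (S.terminal p') (S.flat p'))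
    {c : Letter V E A} (hc : S.IsPathWord (S.terminal p) [c] (S.terminal p')) {h : P}
    (hh : h ∈ S.base) (hval : S.val (S.flat p) * S.ev c = h * S.val (S.flat p')) :
    SyncFellowTravel S.gens (K + 4 * Λ + 1) ((S.flat p).map S.ev) h ((S.flat p').map S.ev) := by
  have hn := NodesMin.of_isMin hS hp hm
  have hn' := NodesMin.of_isMin hS hp' hm'
  have htail : ∀ q : List (Seg A E), NodesMin S q → NodesMin S q.tail := by
    intro q hq
    cases q with
    | nil => trivial
    | cons s q => exact hq.2
  rcases c with ⟨v, x⟩ | e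
  · obtain ⟨rfl, hx, hter⟩ := hc
    refine (syncFellowTravel_of_nodesMin hS hp hp' hter ?_ (htail _ hn) (htail _ hn') hh hval).mono
      (by omega)
    have : IsWordOver (S.X (S.terminal p)) [x] := by
      intro y hy
      obtain rfl : y = x := by simpa using hy
      exact hx
    simpa using this.wordLength_le
  · obtain ⟨hι, hter⟩ := hc
    change S.τ e = S.terminal p' at hter
    by_cases hj : S.Joinable e p
    · have hq : S.IsLPath ((some e, []) :: p) := ⟨hS.nil_mem e, hj, hp⟩
      have h₁ := syncFellowTravel_of_nodesMin hS hq hp' hter (g := 1)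
        (by simpa using wordLength_one_le 1) hn (htail _ hn') hh
        (by rw [val_flat_some]; simpa [ev] using hval)
      have h₂ : SyncFellowTravel S.gens 1 ((S.flat p).map S.ev) 1
          ((S.flat ((some e, []) :: p)).map S.ev) := by
        have := isWordOver_map_ev (isPathWord_flat hS hq)
        rw [flat, List.map_append] at this ⊢
        exact syncFellowTravel_take this (by simp)
      have := h₂.trans h₁
      rw [one_mul] at this
      exact this.mono (by omega)
    · cases p with
      | nil => exact hp.elim
      | cons s q =>
        obtain ⟨i, z⟩ := s
        obtain ⟨f, rfl, rfl, rfl⟩ : ∃ f, i = some f ∧ e = S.bar f ∧ z = [] := by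
          by_contra! hcon
          exact hj ⟨hι, fun f h₁ h₂ => hcon f h₁ h₂⟩
        have hq := hp.2.2
        have hter' : S.terminal q = S.terminal p' := by
          rw [← hter, hS.τ_bar, hp.2.1.ι_eq]
        have h₁ := syncFellowTravel_of_nodesMin hS hq hp' hter' (g := 1)
          (by simpa using wordLength_one_le 1) (htail _ hn.2) (htail _ hn') hh
          (by
            rw [← hval, val_flat_some]; simp [ev, hS.s_bar])
        have h₂ : SyncFellowTravel S.gens 1 ((S.flat q).map S.ev) 1
            ((S.flat ((some f, []) :: q)).map S.ev) := by
          have := isWordOver_map_ev (isPathWord_flat hS hp)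
          rw [flat, List.map_append] at this ⊢
          exact syncFellowTravel_take this (by simp)
        have h₃ : SyncFellowTravel S.gens 1 ((S.flat ((some f, []) :: q)).map S.ev) 1
            ((S.flat q).map S.ev) := fun t => by
          have := cayleyDist_comm_le (h₂ t)
          simpa using this
        have := h₃.trans h₁
        rw [one_mul] at this
        exact this.mono (by omega)

/-- A minimal path is inserted after each letter of `q`. These paths may end at any vertex, which is
why minimality is defined relative to an arbitrary end vertex. -/
theorem syncFellowTravel_chain (q : List (Letter V E A)) {p p' : List (Seg A E)}
    (hp : S.IsLPath p) (hp' : S.IsLPath p')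
    (hm : S.IsMin (S.terminal p) (S.flat p)) (hm' : S.IsMin (S.terminal p') (S.flat p'))
    (hq : S.IsPathWord (S.terminal p) q (S.terminal p')) {h : P}
    (hh : h ∈ S.base) (hval : S.val (S.flat p) * S.val q = h * S.val (S.flat p')) :
    SyncFellowTravel S.gens ((q.length + 1) * (K + 4 * Λ + 1)) ((S.flat p).map S.ev) h
      ((S.flat p').map S.ev) := by
  have htail : ∀ q : List (Seg A E), NodesMin S q → NodesMin S q.tail := by
    intro q hq
    cases q with
    | nil => trivial
    | cons s q => exact hq.2
  induction q generalizing p h with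
  | nil =>
    refine (syncFellowTravel_of_nodesMin hS hp hp' hq (g := 1)
      (by simpa using wordLength_one_le 1) (htail _ (NodesMin.of_isMin hS hp hm))
      (htail _ (NodesMin.of_isMin hS hp' hm')) hh (by simpa using hval)).mono (by simp)
  | cons c q ih =>
    obtain ⟨m, hc, hq⟩ := (isPathWord_append (u₁ := [c]) (u₂ := q)).1 hq
    have hpc := isPathWord_append.2 ⟨_, isPathWord_flat hS hp, hc⟩
    obtain ⟨r, hr, rfl, hrm, k, hk, hkval⟩ := exists_isMin hS hpc
    have h₁ := syncFellowTravel_step hS hp hr hm hrm hc hk (by simpa using hkval)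
    have h₂ := ih hr hrm hq (mul_mem (inv_mem hk) hh) (by
      simp only [val_append, val_cons, val_nil, mul_one] at hkval hval
      rw [← mul_assoc, hkval] at hval
      rw [mul_assoc k⁻¹, ← hval]; group)
    have := h₁.trans h₂
    rw [mul_inv_cancel_left] at this
    exact this.mono (by rw [List.length_cons]; ring_nf; omega)

end Travel

end FlatGraph

end GOG

namespace GOG

theorem isRegular_exists_mem {α ι : Type*} [Finite ι] {L : ι → Language α}
    (hL : ∀ i, (L i).IsRegular) :
    Language.IsRegular ({u | ∃ i, u ∈ L i} : Set (List α)) := by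
  refine isRegular_of_finite_range (fun u i => (L i).leftQuotient u) ?_ ?_ ?_
  · refine (Set.Finite.pi' fun i => (hL i).finite_range_leftQuotient).subset ?_
    rintro _ ⟨u, rfl⟩ i
    exact ⟨u, rfl⟩
  · exact fun u v a h => funext fun i => leftQuotient_snoc_congr a (congrFun h i)
  · rintro u v h ⟨i, hi⟩
    exact ⟨i, (mem_iff_of_leftQuotient_eq (congrFun h i)).1 hi⟩

namespace FlatGraph

variable {V E A P : Type*} [Group A] [Group P] {S : FlatGraph V E A P}

/-! ### A finite parser for reduced paths -/

section Parse

variable (S)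

/-- The language of the words spelled by the reduced paths that end at `a`. -/
def pathLanguage (a : V) : Language (Letter V E A) :=
  {u | ∃ p, S.IsLPath p ∧ S.terminal p = a ∧ S.flat p = u}

/-- The states of a parser for `pathLanguage`: the label of the current segment, the set of words
that complete it, and whether it is empty so far. -/
abbrev ParseState (E A : Type*) := Option (Option E × Language A × Prop)

-- An edge may be read only if the segment before it is complete, and an opposite edge only if that
-- segment is non-empty; `none` is the failure state.
open Classical in
noncomputable def parseStep : ParseState E A → Letter V E A → ParseState E A
  | none, _ => none
  | some (i, Q, _), Sum.inl (v, x) =>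
    if v = S.vtx i then some (i, Q.leftQuotient [x], False) else none
  | some (i, Q, n), Sum.inr e =>
    if S.ι e = S.vtx i ∧ [] ∈ Q ∧ ¬ (n ∧ ∃ f, i = some f ∧ e = S.bar f) then
      some (some e, S.L e, True) else none

noncomputable def parse (u : List (Letter V E A)) : ParseState E A :=
  u.foldl S.parseStep (some (none, S.L S.e₀, True))

/-- Paths whose last segment may be incomplete. -/
def IsPartialPath : List (Seg A E) → Prop
  | [] => False
  | (none, _) :: p => p = []
  | (some e, _) :: p => S.Joinable e p ∧ S.IsLPath p

variable {S}

theorem parse_snoc (u : List (Letter V E A)) (c : Letter V E A) :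
    S.parse (u ++ [c]) = S.parseStep (S.parse u) c := by
  simp [parse]

theorem foldl_parseStep (i : Option E) (Q : Language A) (n : Prop) (z : List A) :
    (z.map fun x => (Sum.inl (S.vtx i, x) : Letter V E A)).foldl S.parseStep (some (i, Q, n)) =
      some (i, Q.leftQuotient z, n ∧ z = []) := by
  induction z generalizing Q n with
  | nil => simp
  | cons x z ih =>
    rw [List.map_cons, List.foldl_cons]
    have : S.parseStep (some (i, Q, n)) (Sum.inl (S.vtx i, x)) =
        some (i, Q.leftQuotient [x], False) := if_pos rfl
    rw [this, ih, ← Language.leftQuotient_append]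
    simp

theorem IsLPath.isPartialPath {p : List (Seg A E)} (hp : S.IsLPath p) : S.IsPartialPath p := by
  rcases p with _ | ⟨⟨_ | e, z⟩, p⟩
  · exact hp
  · exact hp.1
  · exact hp.2

theorem isLPath_iff {i : Option E} {z : List A} {p : List (Seg A E)}
    (hp : S.IsPartialPath ((i, z) :: p)) : S.IsLPath ((i, z) :: p) ↔ z ∈ S.L (S.lab i) := by
  cases i with
  | none => exact ⟨fun h => h.2, fun h => ⟨hp, h⟩⟩
  | some e => exact ⟨fun h => h.1, fun h => ⟨h, hp.1, hp.2⟩⟩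

theorem joinable_iff {e : E} {i : Option E} {z : List A} {p : List (Seg A E)} :
    S.Joinable e ((i, z) :: p) ↔
      S.ι e = S.vtx i ∧ ¬ (z = [] ∧ ∃ f, i = some f ∧ e = S.bar f) := by
  refine and_congr_right fun _ => ?_
  constructor
  · rintro h ⟨hz, f, h₁, h₂⟩
    exact h f h₁ h₂ hz
  · exact fun h f h₁ h₂ hz => h ⟨hz, f, h₁, h₂⟩

theorem parse_flat {p : List (Seg A E)} {i : Option E} {z : List A}
    (hp : S.IsPartialPath ((i, z) :: p)) :
    S.parse (S.flat ((i, z) :: p)) = some (i, (S.L (S.lab i)).leftQuotient z, z = []) := by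
  induction p generalizing i z with
  | nil =>
    cases i with
    | none =>
      have := foldl_parseStep (S := S) none (S.L S.e₀) True z
      rw [true_and] at this
      exact this
    | some e => exact hp.2.elim
  | cons s p ih =>
    cases i with
    | none => simp [IsPartialPath] at hp
    | some e =>
      obtain ⟨j, y⟩ := s
      obtain ⟨hj, hq⟩ := hp
      have hy : y ∈ S.L (S.lab j) := (isLPath_iff hq.isPartialPath).1 hq
      have h₁ := ih hq.isPartialPath
      have h₂ : S.parse (S.flat ((j, y) :: p) ++ [Sum.inr e]) = some (some e, S.L e, True) := by
        rw [parse_snoc, h₁]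
        refine if_pos ⟨(joinable_iff.1 hj).1, ?_, (joinable_iff.1 hj).2⟩
        simpa [Language.mem_leftQuotient] using hy
      have h₃ : S.flat ((some e, z) :: (j, y) :: p) = (S.flat ((j, y) :: p) ++ [Sum.inr e]) ++
          z.map fun x => (Sum.inl (S.vtx (some e), x) : Letter V E A) := by
        rw [List.append_assoc]; rfl
      have h₄ : S.parse (S.flat ((some e, z) :: (j, y) :: p)) =
          (z.map fun x => (Sum.inl (S.vtx (some e), x) : Letter V E A)).foldl S.parseStep
            (S.parse (S.flat ((j, y) :: p) ++ [Sum.inr e])) := by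
        rw [h₃, parse, List.foldl_append]; rfl
      rw [h₄, h₂, foldl_parseStep]
      simp [lab]

/-- With `parse_flat`, this identifies the accepted words with those spelled by paths; uniqueness of
the path is not needed. -/
theorem parse_eq_none_or (u : List (Letter V E A)) :
    S.parse u = none ∨ ∃ i z p, S.IsPartialPath ((i, z) :: p) ∧ S.flat ((i, z) :: p) = u := by
  classical
  induction u using List.reverseRecOn with
  | nil => exact Or.inr ⟨none, [], [], rfl, rfl⟩
  | append_singleton u c ih =>
    rw [parse_snoc]
    rcases ih with h | ⟨i, z, p, hp, rfl⟩
    · left; rw [h]; rfl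
    · rw [parse_flat hp]
      rcases c with ⟨v, x⟩ | e
      · by_cases hv : v = S.vtx i
        · subst hv
          right
          refine ⟨i, z ++ [x], p, ?_, ?_⟩
          · cases i <;> exact hp
          · cases i with
            | none => simp [flat]; rfl
            | some e => simp [flat]; rfl
        · left; exact if_neg hv
      · by_cases hc : S.ι e = S.vtx i ∧ [] ∈ (S.L (S.lab i)).leftQuotient z ∧
          ¬ (z = [] ∧ ∃ f, i = some f ∧ e = S.bar f)
        · right
          refine ⟨some e, [], (i, z) :: p, ⟨joinable_iff.2 ⟨hc.1, hc.2.2⟩, ?_⟩, by simp [flat]⟩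
          refine (isLPath_iff hp).2 ?_
          simpa [Language.mem_leftQuotient] using hc.2.1
        · left; exact if_neg hc

theorem mem_pathLanguage_iff (a : V) (u : List (Letter V E A)) :
    u ∈ S.pathLanguage a ↔ ∃ i Q n, S.parse u = some (i, Q, n) ∧ [] ∈ Q ∧ S.vtx i = a := by
  constructor
  · rintro ⟨p, hp, rfl, rfl⟩
    rcases p with _ | ⟨⟨i, z⟩, p⟩
    · exact hp.elim
    · refine ⟨_, _, _, parse_flat hp.isPartialPath, ?_, rfl⟩
      simpa [Language.mem_leftQuotient] using (isLPath_iff hp.isPartialPath).1 hp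
  · rintro ⟨i, Q, n, h, hQ, rfl⟩
    rcases S.parse_eq_none_or u with h' | ⟨j, z, p, hp, rfl⟩
    · rw [h'] at h; exact absurd h (by simp)
    · rw [parse_flat hp] at h
      simp only [Option.some.injEq, Prod.mk.injEq] at h
      obtain ⟨rfl, rfl, -⟩ := h
      refine ⟨_, (isLPath_iff hp).2 ?_, rfl, rfl⟩
      simpa [Language.mem_leftQuotient] using hQ

theorem isRegular_pathLanguage [Finite E] (hL : ∀ e, (S.L e).IsRegular) (a : V) :
    (S.pathLanguage a).IsRegular := by
  refine isRegular_of_finite_range S.parse ?_ ?_ ?_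
  · have hfin : (Set.univ ×ˢ ((⋃ e, Set.range (S.L e).leftQuotient) ×ˢ Set.univ) :
        Set (Option E × Language A × Prop)).Finite :=
      Set.finite_univ.prod
        ((Set.finite_iUnion fun e => (hL e).finite_range_leftQuotient).prod Set.finite_univ)
    refine ((hfin.image some).insert none).subset ?_
    rintro _ ⟨u, rfl⟩
    rcases S.parse_eq_none_or u with h | ⟨i, z, p, hp, rfl⟩
    · exact Or.inl h
    · right
      rw [parse_flat hp]
      exact ⟨_, ⟨trivial, Set.mem_iUnion.2 ⟨_, z, rfl⟩, trivial⟩, rfl⟩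
  · intro u v c h
    rw [parse_snoc, parse_snoc, h]
  · intro u v h
    rw [mem_pathLanguage_iff, mem_pathLanguage_iff, h]
    exact id

end Parse

/-! ### Regularity of minimality, and the coset system -/

section Minimal

variable {Λ K : ℕ} (hS : S.Good Λ K)

variable (S) in
/-- The words of `pathLanguage` that are shortest in their coset. -/
def minLanguage (a : V) : Language (Letter V E A) :=
  {u | ∃ p, S.IsLPath p ∧ S.terminal p = a ∧ S.IsMin a (S.flat p) ∧ S.flat p = u}

variable (S) in
/-- The words that synchronously fellow travel with a shorter word in the same coset. -/
def reducibleLanguage (M : ℕ) (a : V) : Language (Letter V E A) :=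
  {u | u ∈ S.pathLanguage a ∧ ∃ w ∈ S.pathLanguage a, ∃ h ∈ S.base,
    (u.map S.ev).prod = h * (w.map S.ev).prod ∧ w.length < u.length ∧
      SyncFellowTravel S.gens M (u.map S.ev) h (w.map S.ev)}

include hS

/-- The prefix is the shortest initial subpath ending with a segment that is not minimal. All
shorter ones are minimal, so it fellow travels with a minimal representative of its coset, which is
strictly shorter. -/
theorem exists_prefix_reducible {p : List (Seg A E)} (hp : S.IsLPath p)
    (hm : ¬ NodesMin S p) :
    ∃ b v x, S.flat p = v ++ x ∧ v ∈ S.reducibleLanguage (K + 4 * Λ) b := by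
  induction p with
  | nil => exact hp.elim
  | cons s p ih =>
    by_cases hn : NodesMin S p
    · have hnm : ¬ S.IsMin (S.terminal (s :: p)) (S.flat (s :: p)) := fun h => hm ⟨h, hn⟩
      obtain ⟨q, hq, hter, hqm, h, hh, hval⟩ := exists_isMin hS (isPathWord_flat hS hp)
      refine ⟨S.terminal (s :: p), S.flat (s :: p), [], by simp, ⟨_, hp, rfl, rfl⟩, S.flat q,
        ⟨_, hq, hter, rfl⟩, h, hh, hval, ?_, ?_⟩
      · by_contra! hle
        refine hnm fun w hw ⟨k, hk, hk'⟩ => hle.trans (hqm w hw ⟨h⁻¹ * k,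
          mul_mem (inv_mem hh) hk, ?_⟩)
        rw [mul_assoc, ← hk', hval, inv_mul_cancel_left]
      · refine syncFellowTravel_of_nodesMin hS hp hq hter.symm (g := 1)
          (by simpa using wordLength_one_le 1) hn ?_ hh (by simpa using hval)
        have := NodesMin.of_isMin hS hq (by rw [hter]; exact hqm)
        cases q with
        | nil => trivial
        | cons s q => exact this.2
    · obtain ⟨i, z⟩ := s
      cases i with
      | none => rw [hp.1] at hn; exact (hn trivial).elim
      | some e =>
        obtain ⟨b, v, x, h, hv⟩ := ih hp.2.2 hn
        refine ⟨b, v, x ++ Sum.inr e :: z.map fun x => Sum.inl (S.τ e, x), ?_, hv⟩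
        rw [flat, h, List.append_assoc]

theorem not_isMin_of_prefix {a b : V} {v x : List (Letter V E A)}
    (hu : S.IsPathWord (S.τ S.e₀) (v ++ x) a) {M : ℕ} (hv : v ∈ S.reducibleLanguage M b) :
    ¬ S.IsMin a (v ++ x) := by
  intro hm
  obtain ⟨⟨p, hp, rfl, rfl⟩, _, ⟨q, hq, hter, rfl⟩, h, hh, hval, hlt, -⟩ := hv
  obtain ⟨m, hpm, hx⟩ := isPathWord_append.1 hu
  obtain rfl := hpm.unique (isPathWord_flat hS hp)
  have := (hm.of_append hx) (S.flat q) (by rw [← hter]; exact isPathWord_flat hS hq)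
    ⟨h, hh, hval⟩
  omega

/-- A reduced path is minimal exactly when none of its prefixes is reducible: a reducible prefix
could be replaced by a shorter word, and a non-minimal path has one by `exists_prefix_reducible`. -/
theorem isRegular_minLanguage [Finite V] [Finite E] (hX : S.gens.Finite) (a : V) :
    (S.minLanguage a).IsRegular := by
  have hbad : ∀ b, (S.reducibleLanguage (K + 4 * Λ) b).IsRegular := fun b =>
    IsRegular.exists_shorter hX S.base (K + 4 * Λ) S.ev (isRegular_pathLanguage hS.regular b)
  have h₁ := (IsRegular.prefix_mem (isRegular_exists_mem hbad)).compl
  have h₂ := (isRegular_pathLanguage hS.regular a).inf h₁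
  convert h₂ using 1
  ext u
  constructor
  · rintro ⟨p, hp, rfl, hm, rfl⟩
    refine ⟨⟨p, hp, rfl, rfl⟩, ?_⟩
    rintro ⟨v, x, h, b, hv⟩
    have := isPathWord_flat hS hp
    rw [h] at hm this
    exact not_isMin_of_prefix hS this hv hm
  · rintro ⟨⟨p, hp, rfl, rfl⟩, hn⟩
    refine ⟨p, hp, rfl, ?_, rfl⟩
    by_contra hm
    have hnm : ¬ NodesMin S p := by
      intro h
      cases p with
      | nil => exact hp.elim
      | cons s p => exact hm h.1
    obtain ⟨b, v, x, h, hv⟩ := exists_prefix_reducible hS hp hnm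
    exact hn ⟨v, x, h, b, hv⟩

/-- The pair `(P, base)` is strongly synchronously coset automatic, if the generators of `P` are
represented by closed path words. -/
theorem stronglySyncCosetAutomatic [Finite V] [Finite E] (hXfin : ∀ v, (S.X v).Finite)
    (hgen : Subgroup.closure S.gens = ⊤)
    (hloop : ∀ x, x ∈ S.gens ∨ x⁻¹ ∈ S.gens →
      ∃ q, S.IsPathWord (S.τ S.e₀) q (S.τ S.e₀) ∧ S.val q = x) :
    StronglySyncCosetAutomatic S.base := by
  have hfin : S.gens.Finite := by
    refine Set.Finite.union ?_ (Set.finite_range _)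
    refine (Set.finite_iUnion fun v => (hXfin v).image (S.J v)).subset ?_
    rintro _ ⟨v, a, ha, rfl⟩
    exact Set.mem_iUnion.2 ⟨v, a, ha, rfl⟩
  have hword : ∀ g : P, ∃ q, S.IsPathWord (S.τ S.e₀) q (S.τ S.e₀) ∧ S.val q = g := by
    intro g
    obtain ⟨w, hw, rfl⟩ := exists_isWordOver_of_mem_closure (X := S.gens) (g := g) (by simp [hgen])
    induction w with
    | nil => exact ⟨[], rfl, rfl⟩
    | cons x w ih =>
      obtain ⟨q, hq, hqv⟩ := ih fun y hy => hw y (by simp [hy])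
      obtain ⟨r, hr, rfl⟩ := hloop x (hw x (by simp))
      exact ⟨r ++ q, isPathWord_append.2 ⟨_, hr, hq⟩, by simp [hqv]⟩
  -- The unit ball is finite, so its elements have closed path words of bounded length; this bound
  -- governs the chain of minimal paths.
  obtain ⟨N, hN⟩ : ∃ N : ℕ, ∀ x : P, wordLength S.gens x ≤ 1 →
      ∃ q, S.IsPathWord (S.τ S.e₀) q (S.τ S.e₀) ∧ S.val q = x ∧ q.length ≤ N := by
    choose q hq hqv using hword
    obtain ⟨N, hN⟩ := ((finite_ball hfin 1).image fun x => (q x).length).bddAbove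
    exact ⟨N, fun x hx => ⟨q x, hq x, hqv x, hN ⟨x, by simpa using hx, rfl⟩⟩⟩
  refine ⟨S.gens, hfin, hgen, (List.map S.ev '' S.minLanguage (S.τ S.e₀) : Set (List P)),
    (N + 1) * (K + 4 * Λ + 1), ⟨?_, ?_⟩, IsRegular.image_map (isRegular_minLanguage hS hfin _) S.ev, ?_⟩
  · rintro _ ⟨_, ⟨p, hp, -, -, rfl⟩, rfl⟩
    exact isWordOver_map_ev (isPathWord_flat hS hp)
  · intro g
    obtain ⟨q, hq, rfl⟩ := hword g
    obtain ⟨p, hp, hter, hm, h, hh, hval⟩ := exists_isMin hS hq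
    refine ⟨_, ⟨_, ⟨p, hp, hter, hm, rfl⟩, rfl⟩, h⁻¹, inv_mem hh, ?_⟩
    rw [hval, inv_mul_cancel_left]; rfl
  · rintro _ ⟨_, ⟨p, hp, hter, hm, rfl⟩, rfl⟩ _ ⟨_, ⟨p', hp', hter', hm', rfl⟩, rfl⟩ h hh hd
    obtain ⟨q, hq, hqv, hqN⟩ := hN _ hd
    refine (syncFellowTravel_chain hS q hp hp' (by rwa [hter]) (by rwa [hter'])
      (by rwa [hter, hter']) hh ?_).mono (Nat.mul_le_mul_right _ (by omega))
    rw [hqv]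
    exact mul_inv_cancel_left _ _

end Minimal

end FlatGraph

end GOG

/-! ### Potentials on a maximal tree -/

namespace GOG

namespace DirGraph

variable {V E : Type*} {Γ : DirGraph V E}

theorem IsPath.append {u v w : V} {p q : List E} (hp : Γ.IsPath u p v) (hq : Γ.IsPath v q w) :
    Γ.IsPath u (p ++ q) w := by
  induction p generalizing u with
  | nil => obtain rfl : u = v := hp; exact hq
  | cons e p ih => exact ⟨hp.1, ih hp.2⟩

theorem isPath_append_iff {u w : V} {p q : List E} :
    Γ.IsPath u (p ++ q) w ↔ ∃ v, Γ.IsPath u p v ∧ Γ.IsPath v q w := by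
  induction p generalizing u with
  | nil => simp [IsPath]
  | cons e p ih => simp only [List.cons_append, IsPath, ih, exists_and_left, and_assoc]

theorem IsPath.reverse {u v : V} {p : List E} (hp : Γ.IsPath u p v) :
    Γ.IsPath v (p.map Γ.bar).reverse u := by
  induction p generalizing u with
  | nil => exact hp.symm
  | cons e p ih =>
    rw [List.map_cons, List.reverse_cons]
    exact (ih hp.2).append ⟨Γ.ι_bar e, (Γ.τ_bar e).trans hp.1⟩

/-- A map from the edges to a group that inverts opposite edges is trivial on the closed paths of
a tree. -/
theorem IsMaximalTree.prod_eq_one {T : Set E} (hT : Γ.IsMaximalTree T) {Q : Type*} [Group Q]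
    (σ : E → Q) (hσ : ∀ e, σ (Γ.bar e) = (σ e)⁻¹) (n : ℕ) {v : V} {p : List E} (hn : p.length ≤ n)
    (hp : Γ.IsPath v p v) (hpT : ∀ e ∈ p, e ∈ T) : (p.map σ).prod = 1 := by
  induction n generalizing p with
  | zero =>
    obtain rfl : p = [] := List.length_eq_zero_iff.1 (by omega)
    rfl
  | succ n ih =>
    -- A non-empty closed path in the tree contains some `e` followed by `bar e`; deleting the two
    -- changes neither its ends nor the product.
    by_cases hr : Γ.IsReduced p
    · rw [hT.acyclic v p hp hpT hr]; rfl
    · obtain ⟨l, e, l', rfl⟩ : ∃ l e l', p = l ++ e :: Γ.bar e :: l' := by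
        unfold IsReduced at hr
        rw [List.isChain_iff_forall_rel_of_append_cons_cons] at hr
        push Not at hr
        obtain ⟨a, b, l₁, l₂, h, hb⟩ := hr
        exact ⟨l₁, a, l₂, by rw [h, hb]⟩
      obtain ⟨w, hl, he, hb, hl'⟩ := isPath_append_iff.1 hp
      rw [Γ.τ_bar, he] at hl'
      have := ih (p := l ++ l') (by simp at hn ⊢; omega) (hl.append hl')
        (fun f hf => hpT f (by simp at hf ⊢; tauto))
      simpa [hσ] using this

/-- `θ v` is the product of `σ` along a tree path from `v₀` to `v`. For a tree edge, the paths to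
its two ends and the edge form a closed path, on which the product is trivial. -/
theorem IsMaximalTree.exists_potential {T : Set E} (hT : Γ.IsMaximalTree T) {Q : Type*} [Group Q]
    (σ : E → Q) (hσ : ∀ e, σ (Γ.bar e) = (σ e)⁻¹) (v₀ : V) :
    ∃ θ : V → Q, ∀ e ∈ T, θ (Γ.τ e) = θ (Γ.ι e) * σ e := by
  choose p hp hpT using fun v => hT.exists_path v₀ v
  refine ⟨fun v => ((p v).map σ).prod, fun e he => ?_⟩
  have hclosed : Γ.IsPath v₀ (p (Γ.ι e) ++ [e] ++ ((p (Γ.τ e)).map Γ.bar).reverse) v₀ :=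
    ((hp _).append (show Γ.IsPath (Γ.ι e) [e] (Γ.τ e) from ⟨rfl, rfl⟩)).append (hp _).reverse
  have hinv : ∀ q : List E, ((q.map Γ.bar).reverse.map σ).prod = (q.map σ).prod⁻¹ := by
    intro q
    induction q with
    | nil => simp
    | cons f q ih =>
      simp only [List.map_cons, List.reverse_cons, List.map_append, List.prod_append, ih,
        List.map_nil, List.prod_cons, List.prod_nil, hσ, mul_one, mul_inv_rev]
  have := hT.prod_eq_one σ hσ _ le_rfl hclosed (by
    intro f hf
    simp only [List.mem_append, List.mem_singleton, List.mem_reverse, List.mem_map] at hf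
    rcases hf with (hf | rfl) | ⟨a, ha, rfl⟩
    · exact hpT _ _ hf
    · exact he
    · exact hT.bar_mem _ (hpT _ _ ha))
  rw [List.map_append, List.map_append, List.prod_append, List.prod_append, hinv,
    mul_inv_eq_one] at this
  simpa using this.symm

end DirGraph

/-! ### Embedding the vertex groups in one group -/

namespace GraphOfGroups

variable {V E : Type*} {Γ : DirGraph V E} {G : V → Type*} [∀ v, Group (G v)]

section Embedding

open Classical in
/-- The embedding of a vertex group in the direct product of the vertex groups. -/
noncomputable def single (G : V → Type*) [∀ v, Group (G v)] (v : V) : G v →* ∀ v, G v :=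
  MonoidHom.mulSingle G v

theorem single_apply_self (v : V) (g : G v) : single G v g v = g := by
  simp [single]

theorem single_injective (v : V) : Function.Injective (single G v) := fun a b h => by
  rw [← single_apply_self v a, h, single_apply_self]

theorem prod_map_single (v : V) (z : List (G v)) :
    (z.map (single G v)).prod = single G v z.prod := by rw [map_list_prod]

theorem exists_word_of_isWordOver_image {v : V} {X : Set (G v)} {t : List (∀ v, G v)}
    (ht : IsWordOver (single G v '' X) t) : ∃ t', IsWordOver X t' ∧ t'.map (single G v) = t := by
  induction t with
  | nil => exact ⟨[], IsWordOver.nil, rfl⟩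
  | cons x t ih =>
    obtain ⟨t', ht', rfl⟩ := ih fun y hy => ht y (by simp [hy])
    obtain ⟨a, ha, rfl⟩ : ∃ a, (a ∈ X ∨ a⁻¹ ∈ X) ∧ single G v a = x := by
      rcases ht x (by simp) with ⟨a, ha, h⟩ | ⟨a, ha, h⟩
      · exact ⟨a, Or.inl ha, h⟩
      · exact ⟨a⁻¹, Or.inr (by simpa), by rw [map_inv, h, inv_inv]⟩
    refine ⟨a :: t', fun y hy => ?_, rfl⟩
    rcases List.mem_cons.1 hy with rfl | hy
    exacts [ha, ht' y hy]

theorem isWordOver_map_single {v : V} {X : Set (G v)} {t : List (G v)} (ht : IsWordOver X t) :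
    IsWordOver (single G v '' X) (t.map (single G v)) := by
  intro x hx
  obtain ⟨a, ha, rfl⟩ := List.mem_map.1 hx
  rcases ht a ha with h | h
  · exact Or.inl ⟨a, h, rfl⟩
  · exact Or.inr ⟨a⁻¹, h, map_inv _ _⟩

theorem wordLength_single_iff {v : V} {X : Set (G v)} {g : G v} {n : ℕ} :
    wordLength (single G v '' X) (single G v g) ≤ n ↔ wordLength X g ≤ n := by
  constructor
  · intro h
    have := wordLength_map_le (Z := X) (Pi.evalMonoidHom G v) (by
      rintro _ ⟨a, ha, rfl⟩
      simpa [single_apply_self] using ha) h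
    simpa [single_apply_self] using this
  · exact fun h => wordLength_map_le (single G v) (fun x hx => Set.mem_image_of_mem _ hx) h

theorem image_single_cast {v w : V} (h : v = w) (Y : Set (G w)) :
    single G v '' (h ▸ Y) = single G w '' Y := by
  subst h; rfl

end Embedding

variable (𝒢 : GraphOfGroups Γ G)

open Classical in
/-- The edge groups as subgroups of the direct product of the vertex groups. -/
noncomputable def toHNNSystem : HNNSystem (∀ v, G v) E where
  bar := Γ.bar
  B e := (𝒢.edgeGroup e).map (single G (Γ.τ e))
  -- Only the coordinate at `Γ.τ e` is read; what happens outside `B e` is irrelevant.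
  φ e a := if h : a (Γ.τ e) ∈ 𝒢.edgeGroup e then
    single G (Γ.τ (Γ.bar e)) (𝒢.φ e ⟨a (Γ.τ e), h⟩ : G _) else 1
  bar_bar := Γ.bar_bar
  φ_mem := by
    rintro e _ ⟨g, hg, rfl⟩
    have hg' : single G (Γ.τ e) g (Γ.τ e) ∈ 𝒢.edgeGroup e := by rwa [single_apply_self]
    rw [dif_pos hg']
    exact ⟨_, (𝒢.φ e _).2, rfl⟩
  φ_mul := by
    rintro e _ ⟨g, hg, rfl⟩ _ ⟨h, hh, rfl⟩
    have hg' : single G (Γ.τ e) g (Γ.τ e) ∈ 𝒢.edgeGroup e := by rwa [single_apply_self]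
    have hh' : single G (Γ.τ e) h (Γ.τ e) ∈ 𝒢.edgeGroup e := by rwa [single_apply_self]
    rw [dif_pos hg', dif_pos hh', dif_pos (by exact mul_mem hg' hh')]
    have h : (𝒢.φ e (⟨_, hg'⟩ * ⟨_, hh'⟩) : G (Γ.τ (Γ.bar e))) = 𝒢.φ e ⟨_, hg'⟩ * 𝒢.φ e ⟨_, hh'⟩ :=
      congrArg Subtype.val (map_mul (𝒢.φ e) _ _)
    exact (congrArg (single G (Γ.τ (Γ.bar e))) h).trans (map_mul _ _ _)
  φ_φ := by
    rintro e _ ⟨g, hg, rfl⟩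
    have hg' : single G (Γ.τ e) g (Γ.τ e) ∈ 𝒢.edgeGroup e := by rwa [single_apply_self]
    rw [dif_pos hg']
    have hb := (𝒢.φ e ⟨_, hg'⟩).2
    have hb' : single G (Γ.τ (Γ.bar e)) (𝒢.φ e ⟨_, hg'⟩ : G _) (Γ.τ (Γ.bar e)) ∈
        𝒢.edgeGroup (Γ.bar e) := by rwa [single_apply_self]
    rw [dif_pos hb']
    have h := congrArg (fun x : Σ e : E, 𝒢.edgeGroup e => single G (Γ.τ x.1) (x.2 : G _))
      (𝒢.φ_bar e ⟨_, hg'⟩)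
    simp only [single_apply_self] at h ⊢
    exact h

theorem toHNNSystem_φ (e : E) (g : 𝒢.edgeGroup e) :
    𝒢.toHNNSystem.φ e (single G (Γ.τ e) g) = single G (Γ.τ (Γ.bar e)) (𝒢.φ e g : G _) := by
  have hg : single G (Γ.τ e) (g : G _) (Γ.τ e) ∈ 𝒢.edgeGroup e := by
    rw [single_apply_self]; exact g.2
  refine (dif_pos hg).trans ?_
  congr 3
  exact Subtype.ext (single_apply_self _ _)

variable (T : Set E) (X : ∀ v, Set (G v)) (Y : ∀ e, Set (G (Γ.τ e)))
  (L : ∀ e, Language (G (Γ.τ e))) (e₀ : E)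

/-- A stable letter in the fundamental group. -/
def stableLetter (e : E) : 𝒢.Pi1 T := PresentedGroup.mk {r | Relator 𝒢 T r} (genE G e)

/-- The graph of groups, with its vertex groups embedded in their direct product. -/
noncomputable def toFlat : FlatGraph V E (∀ v, G v) (𝒢.Pi1 T) where
  toHNNSystem := 𝒢.toHNNSystem
  ι := Γ.ι
  τ := Γ.τ
  X v := single G v '' X v
  Y e := single G (Γ.τ e) '' Y e
  L e := (List.map (single G (Γ.τ e)) '' L e : Set (List (∀ v, G v)))
  -- The other coordinates are forgotten; at `v` the map is applied to elements of the embedded `G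
  -- v`.
  J v := (𝒢.ofVertex T v).comp (Pi.evalMonoidHom G v)
  s := 𝒢.stableLetter T
  e₀ := e₀

variable {T}

theorem stableLetter_bar (e : E) : 𝒢.stableLetter T (Γ.bar e) = (𝒢.stableLetter T e)⁻¹ := by
  have h : PresentedGroup.mk {r | Relator 𝒢 T r} (genE G (Γ.bar e) * genE G e) = 1 :=
    PresentedGroup.one_of_mem (Relator.bar e)
  rw [map_mul] at h
  exact eq_inv_of_mul_eq_one_left h

theorem stableLetter_eq_one {e : E} (he : e ∈ T) : 𝒢.stableLetter T e = 1 :=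
  PresentedGroup.one_of_mem (Relator.tree e he)

theorem stableLetter_conj (e : E) (g : 𝒢.edgeGroup e) :
    𝒢.stableLetter T e * 𝒢.ofVertex T (Γ.τ e) g =
      𝒢.ofVertex T (Γ.τ (Γ.bar e)) (𝒢.φ e g : G _) * 𝒢.stableLetter T e := by
  have h := PresentedGroup.one_of_mem (rels := {r | Relator 𝒢 T r}) (Relator.conj (T := T) e g)
  rw [map_mul, map_mul, map_mul, map_inv, map_inv, mul_inv_eq_one, mul_inv_eq_iff_eq_mul] at h
  exact h

theorem base_toFlat : (𝒢.toFlat T X Y L e₀).base = 𝒢.edgeSubgroup T e₀ := by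
  change ((𝒢.edgeGroup e₀).map (single G (Γ.τ e₀))).map
    ((𝒢.ofVertex T (Γ.τ e₀)).comp (Pi.evalMonoidHom G (Γ.τ e₀))) = _
  rw [Subgroup.map_map]
  congr 1
  ext g
  simp [single_apply_self]

/-! ### The normal form theorem for the fundamental group -/

section NormalForm

variable (T) in
/-- The fundamental group acts on the normal forms, after a twist by a potential on the tree. -/
theorem exists_hom_permGroup {θ : V → 𝒢.toHNNSystem.PermGroup}
    (hθ : ∀ e ∈ T, θ (Γ.τ e) = θ (Γ.ι e) * 𝒢.toHNNSystem.stable e) :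
    ∃ ρ : 𝒢.Pi1 T →* 𝒢.toHNNSystem.PermGroup,
      (∀ v g, ρ (𝒢.ofVertex T v g) =
        θ v * 𝒢.toHNNSystem.right (single G v g) * (θ v)⁻¹) ∧
      ∀ e, ρ (𝒢.stableLetter T e) = θ (Γ.ι e) * 𝒢.toHNNSystem.stable e * (θ (Γ.τ e))⁻¹ := by
  -- Stable letters of tree edges move the stacks, whereas `s_e = 1` in the fundamental group. The
  -- twist by `θ` makes their images trivial and respects the remaining relations.
  let f : ((Σ v, G v) ⊕ E) → 𝒢.toHNNSystem.PermGroup := Sum.elim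
    (fun x => θ x.1 * 𝒢.toHNNSystem.right (single G x.1 x.2) * (θ x.1)⁻¹)
    (fun e => θ (Γ.ι e) * 𝒢.toHNNSystem.stable e * (θ (Γ.τ e))⁻¹)
  have hV : ∀ v g, FreeGroup.lift f (genV E v g) =
      θ v * 𝒢.toHNNSystem.right (single G v g) * (θ v)⁻¹ := fun v g => by
    rw [genV, FreeGroup.lift_apply_of]; rfl
  have hE : ∀ e, FreeGroup.lift f (genE G e) =
      θ (Γ.ι e) * 𝒢.toHNNSystem.stable e * (θ (Γ.τ e))⁻¹ := fun e => by
    rw [genE, FreeGroup.lift_apply_of]; rfl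
  have hrel : ∀ r ∈ {r | Relator 𝒢 T r}, FreeGroup.lift f r = 1 := by
    rintro r hr
    cases hr with
    | mul v a b =>
      simp only [map_mul, map_inv, hV]
      group
    | bar e =>
      have := 𝒢.toHNNSystem.stable_bar e
      change 𝒢.toHNNSystem.stable (Γ.bar e) = _ at this
      rw [map_mul, hE, hE, this, Γ.ι_bar, Γ.τ_bar]
      group
    | tree e he => rw [hE, hθ e he]; group
    | conj e g =>
      have := 𝒢.toHNNSystem.stable_mul_right e (b := single G (Γ.τ e) g) ⟨_, g.2, rfl⟩
      rw [toHNNSystem_φ] at this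
      rw [map_mul, map_mul, map_mul, map_inv, map_inv, hE, hV, hV, mul_inv_eq_one,
        mul_inv_eq_iff_eq_mul, show θ (Γ.τ (Γ.bar e)) = θ (Γ.ι e) from congrArg θ (Γ.τ_bar e)]
      calc _ = θ (Γ.ι e) * (𝒢.toHNNSystem.stable e *
            𝒢.toHNNSystem.right (single G (Γ.τ e) (g : G _))) * (θ (Γ.τ e))⁻¹ := by group
        _ = _ := by rw [this]; group
  refine ⟨PresentedGroup.toGroup hrel, fun v g => ?_, fun e => ?_⟩
  · exact (PresentedGroup.toGroup.of (f := f) hrel).trans rfl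
  · exact (PresentedGroup.toGroup.of (f := f) hrel).trans rfl

variable {X Y L e₀}

theorem toFlat_eq_nil (hLone : ∀ e, ∀ w : List (G (Γ.τ e)),
    (w ∈ L e ∧ w.prod ∈ 𝒢.edgeGroup e) ↔ w = []) (e : E) :
    ∀ z ∈ (𝒢.toFlat T X Y L e₀).L e, z.prod ∈ (𝒢.toFlat T X Y L e₀).B e → z = [] := by
  rintro _ ⟨z, hz, rfl⟩ ⟨g, hg, h⟩
  rw [prod_map_single] at h
  obtain rfl := single_injective _ h
  rw [(hLone e z).1 ⟨hz, hg⟩]; rfl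

theorem toFlat_isReduced (hLone : ∀ e, ∀ w : List (G (Γ.τ e)),
    (w ∈ L e ∧ w.prod ∈ 𝒢.edgeGroup e) ↔ w = []) {p : List (Seg (∀ v, G v) E)}
    (hp : (𝒢.toFlat T X Y L e₀).IsLPath p) : 𝒢.toHNNSystem.IsReduced p := by
  induction p with
  | nil => exact hp.elim
  | cons s p ih =>
    obtain ⟨i, z⟩ := s
    cases i with
    | none => exact hp.1
    | some e =>
      obtain ⟨-, hj, hp⟩ := hp
      refine ⟨?_, ih hp⟩
      rintro f y q rfl rfl hm
      exact hj.2 f rfl rfl (𝒢.toFlat_eq_nil hLone f y hp.1 hm)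

/-- The twists telescope, because each edge starts at the vertex where the path before it ends. -/
theorem map_val_toFlat {θ : V → 𝒢.toHNNSystem.PermGroup}
    {ρ : 𝒢.Pi1 T →* 𝒢.toHNNSystem.PermGroup}
    (hV : ∀ v g, ρ (𝒢.ofVertex T v g) = θ v * 𝒢.toHNNSystem.right (single G v g) * (θ v)⁻¹)
    (hE : ∀ e, ρ (𝒢.stableLetter T e) =
      θ (Γ.ι e) * 𝒢.toHNNSystem.stable e * (θ (Γ.τ e))⁻¹) {p : List (Seg (∀ v, G v) E)}
    (hp : (𝒢.toFlat T X Y L e₀).IsLPath p) :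
    ρ ((𝒢.toFlat T X Y L e₀).val ((𝒢.toFlat T X Y L e₀).flat p)) =
      θ (Γ.τ e₀) * 𝒢.toHNNSystem.eval p * (θ ((𝒢.toFlat T X Y L e₀).terminal p))⁻¹ := by
  have hJ : ∀ e, ∀ z ∈ (𝒢.toFlat T X Y L e₀).L e,
      ρ ((𝒢.toFlat T X Y L e₀).J (Γ.τ e) z.prod) =
        θ (Γ.τ e) * 𝒢.toHNNSystem.right z.prod * (θ (Γ.τ e))⁻¹ := by
    rintro e _ ⟨z, -, rfl⟩
    rw [prod_map_single, ← hV]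
    change ρ (𝒢.ofVertex T (Γ.τ e) (single G (Γ.τ e) z.prod (Γ.τ e))) = _
    rw [single_apply_self]
  induction p with
  | nil => exact hp.elim
  | cons s p ih =>
    obtain ⟨i, z⟩ := s
    cases i with
    | none =>
      rw [FlatGraph.val_flat_none]
      exact hJ _ _ hp.2
    | some e =>
      obtain ⟨hz, hj, hp⟩ := hp
      rw [FlatGraph.val_flat_some, map_mul, map_mul, ih hp, ← hj.ι_eq]
      have h₁ := hJ e z hz
      have h₂ := hE e
      change _ * ρ (𝒢.stableLetter T e) * ρ ((𝒢.toFlat T X Y L e₀).J (Γ.τ e) z.prod) = _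
      rw [h₁, h₂]
      change θ (Γ.τ e₀) * 𝒢.toHNNSystem.eval p * (θ (Γ.ι e))⁻¹ * _ * _ =
        θ (Γ.τ e₀) * (𝒢.toHNNSystem.eval p * 𝒢.toHNNSystem.stable e *
          𝒢.toHNNSystem.right z.prod) * (θ (Γ.τ e))⁻¹
      group

/-- The normal form theorem: equal elements are represented by matched reduced paths. -/
theorem matched_of_val_eq (hT : Γ.IsMaximalTree T) (hLone : ∀ e, ∀ w : List (G (Γ.τ e)),
    (w ∈ L e ∧ w.prod ∈ 𝒢.edgeGroup e) ↔ w = []) {p p' : List (Seg (∀ v, G v) E)}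
    (hp : (𝒢.toFlat T X Y L e₀).IsLPath p) (hp' : (𝒢.toFlat T X Y L e₀).IsLPath p')
    (hter : (𝒢.toFlat T X Y L e₀).terminal p = (𝒢.toFlat T X Y L e₀).terminal p')
    (g : G ((𝒢.toFlat T X Y L e₀).terminal p)) (b : G (Γ.τ e₀)) (hb : b ∈ 𝒢.edgeGroup e₀)
    (h : (𝒢.toFlat T X Y L e₀).val ((𝒢.toFlat T X Y L e₀).flat p) * 𝒢.ofVertex T _ g =
      𝒢.ofVertex T _ b * (𝒢.toFlat T X Y L e₀).val ((𝒢.toFlat T X Y L e₀).flat p')) :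
    Matched 𝒢.toHNNSystem.B 𝒢.toHNNSystem.φ (𝒢.toHNNSystem.B e₀) (single G _ g) p p' := by
  obtain ⟨θ, hθ⟩ := hT.exists_potential 𝒢.toHNNSystem.stable
    (fun e => 𝒢.toHNNSystem.stable_bar e) (Γ.τ e₀)
  obtain ⟨ρ, hV, hE⟩ := 𝒢.exists_hom_permGroup T hθ
  refine 𝒢.toHNNSystem.matched_of_eval (h := single G _ b)
    (show _ ∈ (𝒢.edgeGroup e₀).map (single G (Γ.τ e₀)) from ⟨b, hb, rfl⟩)
    (𝒢.toFlat_isReduced hLone hp) (𝒢.toFlat_isReduced hLone hp') ?_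
  have := congrArg ρ h
  rw [map_mul, map_mul, 𝒢.map_val_toFlat hV hE hp, 𝒢.map_val_toFlat hV hE hp', hV, hV, ← hter]
    at this
  have e₁ : θ (Γ.τ e₀) * (𝒢.toHNNSystem.eval p * 𝒢.toHNNSystem.right (single G _ g)) *
      (θ ((𝒢.toFlat T X Y L e₀).terminal p))⁻¹ =
      θ (Γ.τ e₀) * (𝒢.toHNNSystem.right (single G _ b) * 𝒢.toHNNSystem.eval p') *
      (θ ((𝒢.toFlat T X Y L e₀).terminal p))⁻¹ := by
    refine Eq.trans ?_ (this.trans ?_) <;> group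
  exact mul_left_cancel (mul_right_cancel e₁)

end NormalForm

end GraphOfGroups

end GOG

/-! ### Uniform constants and verification of the hypotheses -/

namespace GOG

/-- A positive multiple of a crossover constant is again one, so the product of all of them works
for every pair of edges; the factor `∑ N e + 1` makes it at least every `N e`. -/
theorem exists_uniform_crossover {V E : Type*} [Finite E] {G : V → Type*} [∀ v, Group (G v)]
    (τ : E → V) (Y : ∀ e, Set (G (τ e))) (L : ∀ e, Language (G (τ e))) (X : ∀ v, Set (G v))
    (hL : ∀ e, IsCosetLanguage (X (τ e)) (Subgroup.closure (Y e)) (L e))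
    (hcross : ∀ (e f : E) (hef : τ e = τ f), HasLimitedCrossover (L e) (Y e) (hef ▸ Y f))
    (N : E → ℕ) :
    ∃ Λ : ℕ, 1 ≤ Λ ∧ (∀ e, N e ≤ Λ) ∧ ∀ (e f : E) (hef : τ e = τ f),
      HasLimitedCrossoverWith Λ (L e) (Y e) (hef ▸ Y f) := by
  classical
  have := Fintype.ofFinite E
  choose l hl hlc using hcross
  let m : E × E → ℕ := fun x => if h : τ x.1 = τ x.2 then l x.1 x.2 h else 1
  have hm : 1 ≤ ∏ x, m x := by
    refine Finset.one_le_prod' fun x _ => ?_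
    dsimp only [m]
    split_ifs with h
    exacts [hl _ _ h, le_rfl]
  refine ⟨(∑ e, N e + 1) * ∏ x, m x, Nat.mul_pos (by omega) hm, fun e => ?_, fun e f hef => ?_⟩
  · calc N e ≤ ∑ e, N e := Finset.single_le_sum (fun _ _ => Nat.zero_le _) (Finset.mem_univ e)
      _ ≤ (∑ e, N e + 1) * 1 := by omega
      _ ≤ _ := Nat.mul_le_mul_left _ hm
  · have hdvd : l e f hef ∣ (∑ e, N e + 1) * ∏ x, m x := by
      refine Dvd.dvd.mul_left ?_ _
      have h : m (e, f) = l e f hef := dif_pos hef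
      rw [← h]
      exact Finset.dvd_prod_of_mem m (Finset.mem_univ _)
    obtain ⟨k, hk⟩ := hdvd
    have hpos : 0 < (∑ e, N e + 1) * ∏ x, m x := Nat.mul_pos (by omega) hm
    obtain ⟨k, rfl⟩ : ∃ j, k = j + 1 := Nat.exists_eq_succ_of_ne_zero (by
      rintro rfl
      omega)
    rw [hk, mul_comm]
    exact (hlc e f hef).mul (hL e) k

namespace GraphOfGroups

variable {V E : Type*} {Γ : DirGraph V E} {G : V → Type*} [∀ v, Group (G v)]
  (𝒢 : GraphOfGroups Γ G) {X : ∀ v, Set (G v)} {Y : ∀ e, Set (G (Γ.τ e))}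
  {L : ∀ e, Language (G (Γ.τ e))} {T : Set E} {e₀ : E}

theorem wordLength_φ_le (hYgen : ∀ e, Subgroup.closure (Y e) = 𝒢.edgeGroup e)
    (hstable : ∀ e, IsStable 1 (𝒢.φ e) (Y e) (Y (Γ.bar e))) (e : E)
    {y : List (G (Γ.τ e))} (hy : IsWordOver (Y e) y) (hm : y.prod ∈ 𝒢.edgeGroup e) :
    wordLength (Y (Γ.bar e)) (𝒢.φ e ⟨y.prod, hm⟩ : G _) ≤ (y.length : ℕ) := by
  induction y with
  | nil =>
    have : (⟨([] : List (G (Γ.τ e))).prod, hm⟩ : 𝒢.edgeGroup e) = 1 := rfl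
    rw [this, map_one]
    exact wordLength_one_le _
  | cons x y ih =>
    have hy' : IsWordOver (Y e) y := fun z hz => hy z (by simp [hz])
    have hx' : IsWordOver (Y e) [x] := fun z hz => hy z (by simp_all)
    have hym : y.prod ∈ 𝒢.edgeGroup e := by rw [← hYgen]; exact hy'.prod_mem
    have hxm : x ∈ 𝒢.edgeGroup e := by rw [← hYgen]; simpa using hx'.prod_mem
    have h : (⟨(x :: y).prod, hm⟩ : 𝒢.edgeGroup e) = ⟨x, hxm⟩ * ⟨y.prod, hym⟩ :=
      Subtype.ext List.prod_cons
    rw [h, map_mul, List.length_cons, add_comm]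
    refine wordLength_mul_le ?_ (ih hy' hym)
    have := hstable e ⟨x, hxm⟩ (by simpa using hx'.wordLength_le)
    simpa using this

theorem good_toFlat [Finite E] (hXfin : ∀ v, (X v).Finite)
    (hYgen : ∀ e, Subgroup.closure (Y e) = 𝒢.edgeGroup e)
    (hYX : ∀ e, Y e ⊆ X (Γ.τ e))
    (hL : ∀ e, ∃ K : ℕ, IsStrongSyncCosetSystem (X (Γ.τ e)) (𝒢.edgeGroup e) (L e) K)
    (hLgeo : ∀ e, ∀ w ∈ L e, w ∈ Geo (X (Γ.τ e)))
    (hLone : ∀ e, ∀ w : List (G (Γ.τ e)), (w ∈ L e ∧ w.prod ∈ 𝒢.edgeGroup e) ↔ w = [])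
    (hLdec : ∀ e, ∀ g : G (Γ.τ e), ∃ y z : List (G (Γ.τ e)),
      IsWordOver (Y e) y ∧ z ∈ L e ∧ (y ++ z) ∈ Geo (X (Γ.τ e)) ∧ (y ++ z).prod = g)
    (hstable : ∀ e, IsStable 1 (𝒢.φ e) (Y e) (Y (Γ.bar e)))
    (hcross : ∀ (e f : E) (hef : Γ.τ e = Γ.τ f),
      HasLimitedCrossover (L e) (Y e) (hef ▸ Y f))
    (hT : Γ.IsMaximalTree T) :
    ∃ Λ K, (𝒢.toFlat T X Y L e₀).Good Λ K := by
  classical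
  have := Fintype.ofFinite E
  choose k hk using hL
  have hk' : ∀ e, IsStrongSyncCosetSystem (X (Γ.τ e)) (Subgroup.closure (Y e)) (L e) (k e) :=
    fun e => by rw [hYgen]; exact hk e
  choose N hN using fun e => (hk' e).exists_wordLength_bound (hXfin _)
  obtain ⟨Λ, hΛ, hNΛ, hc⟩ := exists_uniform_crossover Γ.τ Y L X
    (fun e => (hk' e).isCosetLanguage) hcross N
  have hmem : ∀ e (g : G (Γ.τ e)), single G (Γ.τ e) g ∈ 𝒢.toHNNSystem.B e →
      g ∈ 𝒢.edgeGroup e := by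
    rintro e g ⟨g', hg', h⟩
    rwa [← single_injective _ h]
  have hprod : ∀ v (u w : List (G v)) (g : G v), (u.map (single G v)).prod * single G v g *
      (w.map (single G v)).prod⁻¹ = single G v (u.prod * g * w.prod⁻¹) := by
    intro v u w g
    rw [prod_map_single, prod_map_single, map_mul, map_mul, map_inv]
  -- `(Λ + 1) * k e` is the constant for words of `L e` at distance Λ; the sum bounds all `k e` at
  -- once.
  refine ⟨Λ, (Λ + 1) * ∑ e, k e, ?_⟩
  constructor
  case B_eq =>
    intro e
    change (𝒢.edgeGroup e).map (single G (Γ.τ e)) = Subgroup.closure (single G (Γ.τ e) '' Y e)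
    rw [← hYgen, MonoidHom.map_closure]
  case ι_bar => exact Γ.ι_bar
  case τ_bar => exact Γ.τ_bar
  case Y_sub => exact fun e => Set.image_mono (hYX e)
  case word =>
    rintro e _ ⟨z, hz, rfl⟩
    exact isWordOver_map_single (hLgeo e z hz).1
  case geo =>
    change ∀ e, ∀ z ∈ List.map (single G (Γ.τ e)) '' (L e : Set (List (G (Γ.τ e)))), ∀ t,
      IsWordOver (single G (Γ.τ e) '' X (Γ.τ e)) t → t.prod = z.prod → z.length ≤ t.length
    rintro e _ ⟨z, hz, rfl⟩ t ht h
    obtain ⟨t, ht', rfl⟩ := exists_word_of_isWordOver_image ht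
    rw [prod_map_single, prod_map_single] at h
    simpa using (hLgeo e z hz).2 t ht' (single_injective _ h)
  case dec =>
    intro e t ht
    change IsWordOver (single G (Γ.τ e) '' X (Γ.τ e)) t at ht
    obtain ⟨t, ht', rfl⟩ := exists_word_of_isWordOver_image ht
    obtain ⟨y, z, hy, hz, hgeo, hp⟩ := hLdec e t.prod
    refine ⟨_, _, isWordOver_map_single hy, ⟨z, hz, rfl⟩, ?_, ?_⟩
    · rw [prod_map_single, prod_map_single, prod_map_single, ← map_mul, ← hp, List.prod_append]
    · simpa using hgeo.2 t ht' hp.symm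
  case nil_mem => exact fun e => ⟨[], ((hLone e []).2 rfl).1, rfl⟩
  case eq_nil => exact 𝒢.toFlat_eq_nil hLone
  case regular => exact fun e => IsRegular.image_map (hk e).isRegular _
  case φ_word =>
    intro e y hy
    obtain ⟨y, hy', rfl⟩ := exists_word_of_isWordOver_image hy
    have hm : y.prod ∈ 𝒢.edgeGroup e := by rw [← hYgen]; exact hy'.prod_mem
    obtain ⟨y₁, hy₁, hp, hl⟩ := (wordLength_le_iff _ _ _).1
      (𝒢.wordLength_φ_le hYgen hstable e hy' hm)
    refine ⟨y₁.map (single G (Γ.τ (Γ.bar e))), isWordOver_map_single hy₁, by simpa using hl, ?_⟩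
    refine (prod_map_single _ _).trans ?_
    rw [prod_map_single, hp]
    exact (𝒢.toHNNSystem_φ e ⟨y.prod, hm⟩).symm
  case one_le => exact hΛ
  case cross =>
    intro e f hef
    change Γ.τ e = Γ.τ f at hef
    rintro _ ⟨u, hu, rfl⟩ _ ⟨v, hv, rfl⟩ g hg huv
    have hg' : wordLength (single G (Γ.τ e) '' (hef ▸ Y f)) g ≤ Λ := by
      rw [image_single_cast hef]; exact hg
    obtain ⟨w, hw, rfl, hwn⟩ := (wordLength_le_iff _ _ _).1 hg'
    obtain ⟨w, hw', rfl⟩ := exists_word_of_isWordOver_image hw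
    rw [prod_map_single _ w, hprod] at huv ⊢
    refine wordLength_single_iff.2 (hc e f hef _ hw'.prod_mem
      (wordLength_le_of_le hw'.wordLength_le (by simpa using hwn)) u hu v hv ?_)
    rw [hYgen]
    exact hmem _ _ huv
  case cross_one =>
    rintro e _ ⟨u, hu, rfl⟩ _ ⟨v, hv, rfl⟩ g hg huv
    obtain ⟨w, hw, rfl, hwn⟩ := (wordLength_le_iff (single G (Γ.τ e) '' X (Γ.τ e)) g 1).1
      (hg.trans (by simp))
    obtain ⟨w, hw', rfl⟩ := exists_word_of_isWordOver_image hw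
    rw [prod_map_single _ w, hprod] at huv ⊢
    refine wordLength_single_iff.2 (wordLength_le_of_le (hN e u hu v hv w.prod ?_ ?_) (hNΛ e))
    · exact hw'.wordLength_le.trans (by exact_mod_cast (by simpa using hwn : w.length ≤ 1))
    · rw [hYgen]
      exact hmem _ _ huv
  case travel =>
    rintro e _ ⟨u, hu, rfl⟩ _ ⟨v, hv, rfl⟩ _ ⟨h, hh, rfl⟩ hd
    have hcd : ∀ (a b c : G (Γ.τ e)) (n : ℕ),
        cayleyDist (single G (Γ.τ e) '' X (Γ.τ e)) (single G _ a)
          (single G _ b * single G _ c) ≤ n ↔ cayleyDist (X (Γ.τ e)) a (b * c) ≤ n := by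
      intro a b c n
      rw [cayleyDist, ← map_mul, ← map_inv, ← map_mul, wordLength_single_iff]; rfl
    rw [prod_map_single, prod_map_single] at hd
    have := (hk e).syncFellowTravel_of_cayleyDist_le Λ hu hv hh ((hcd _ _ _ _).1 hd)
    intro t
    rw [← List.map_take, ← List.map_take, prod_map_single, prod_map_single]
    refine (hcd _ _ _ _).2 (wordLength_le_of_le (this t) (Nat.mul_le_mul_left _ ?_))
    exact Finset.single_le_sum (fun _ _ => Nat.zero_le _) (Finset.mem_univ e)
  case s_bar => exact 𝒢.stableLetter_bar
  case s_conj =>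
    rintro e _ ⟨g, hg, rfl⟩
    have h₁ := 𝒢.stableLetter_conj (T := T) e ⟨g, hg⟩
    change _ * 𝒢.ofVertex T (Γ.τ e) (single G _ g (Γ.τ e)) = 𝒢.ofVertex T _ (𝒢.toHNNSystem.φ e _ (Γ.ι e)) * _
    rw [single_apply_self, 𝒢.toHNNSystem_φ e ⟨g, hg⟩]
    refine h₁.trans (congrArg (· * _) ?_)
    -- `φ_e` takes values at the vertex `τ (bar e)`, whose equality with `ι e` is only
    -- propositional; the direct product allows the coordinate to be read at either.
    have : ∀ v (hv : v = Γ.τ (Γ.bar e)) (x : G (Γ.τ (Γ.bar e))),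
        𝒢.ofVertex T _ x = 𝒢.ofVertex T v (single G _ x v) := by
      rintro _ rfl x
      rw [single_apply_self]
    exact this _ (Γ.τ_bar e).symm _
  case nf =>
    intro p p' hp hp' hter g hg b hb h
    obtain ⟨w, hw, rfl⟩ := exists_isWordOver_of_mem_closure hg
    obtain ⟨w, hw', rfl⟩ := exists_word_of_isWordOver_image hw
    change b ∈ (𝒢.edgeGroup e₀).map (single G (Γ.τ e₀)) at hb
    obtain ⟨b, hb, rfl⟩ := hb
    rw [prod_map_single] at h ⊢
    refine 𝒢.matched_of_val_eq hT hLone hp hp' hter w.prod b hb ?_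
    change _ * 𝒢.ofVertex T _ (single G _ w.prod _) =
      𝒢.ofVertex T _ (single G _ b (Γ.τ e₀)) * _ at h
    rwa [single_apply_self, single_apply_self] at h

theorem exists_isPathWord_of_mem_tree (hT : Γ.IsMaximalTree T) (v w : V) :
    ∃ q, (𝒢.toFlat T X Y L e₀).IsPathWord v q w ∧ (𝒢.toFlat T X Y L e₀).val q = 1 := by
  obtain ⟨p, hp, hpT⟩ := hT.exists_path v w
  refine ⟨p.map Sum.inr, ?_, ?_⟩
  · clear hpT
    induction p generalizing v with
    | nil => exact hp
    | cons e p ih => exact ⟨hp.1, ih _ hp.2⟩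
  · clear hp
    induction p with
    | nil => rfl
    | cons e p ih =>
      rw [List.map_cons, FlatGraph.val_cons, ih fun f hf => hpT f (by simp [hf]), mul_one]
      exact 𝒢.stableLetter_eq_one (hpT e (by simp))

/-- Tree paths have value 1, so they lead from `u` to the letter and back to `u` without changing
the element. -/
theorem exists_loop (hT : Γ.IsMaximalTree T) {v w : V}
    {c : Letter V E (∀ v, G v)} (hc : (𝒢.toFlat T X Y L e₀).IsPathWord v [c] w) (u : V) :
    ∃ q, (𝒢.toFlat T X Y L e₀).IsPathWord u q u ∧
      (𝒢.toFlat T X Y L e₀).val q = (𝒢.toFlat T X Y L e₀).ev c := by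
  obtain ⟨q, hq, hq₁⟩ := 𝒢.exists_isPathWord_of_mem_tree (X := X) (Y := Y) (L := L) (e₀ := e₀) hT u v
  obtain ⟨r, hr, hr₁⟩ := 𝒢.exists_isPathWord_of_mem_tree (X := X) (Y := Y) (L := L) (e₀ := e₀) hT w u
  exact ⟨q ++ [c] ++ r, FlatGraph.isPathWord_append.2
    ⟨w, FlatGraph.isPathWord_append.2 ⟨v, hq, hc⟩, hr⟩, by simp [hq₁, hr₁]⟩

theorem exists_loop_of_mem_gens (hT : Γ.IsMaximalTree T) (u : V) (x : 𝒢.Pi1 T)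
    (hx : x ∈ (𝒢.toFlat T X Y L e₀).gens ∨ x⁻¹ ∈ (𝒢.toFlat T X Y L e₀).gens) :
    ∃ q, (𝒢.toFlat T X Y L e₀).IsPathWord u q u ∧ (𝒢.toFlat T X Y L e₀).val q = x := by
  rcases hx with (⟨v, a, ha, rfl⟩ | ⟨e, rfl⟩) | (⟨v, a, ha, h⟩ | ⟨e, h⟩)
  · exact 𝒢.exists_loop hT (c := Sum.inl (v, a)) ⟨rfl, Or.inl ha, rfl⟩ u
  · exact 𝒢.exists_loop hT (c := Sum.inr e) ⟨rfl, rfl⟩ u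
  · have hxa : x = (𝒢.toFlat T X Y L e₀).J v a⁻¹ := by rw [map_inv, ← h, inv_inv]
    rw [hxa]
    exact 𝒢.exists_loop hT (c := Sum.inl (v, a⁻¹)) ⟨rfl, Or.inr (by simpa using ha), rfl⟩ u
  · have hxe : x = 𝒢.stableLetter T (Γ.bar e) := by
      rw [𝒢.stableLetter_bar]; exact (inv_eq_iff_eq_inv.2 h).symm
    rw [hxe]
    exact 𝒢.exists_loop hT (c := Sum.inr (Γ.bar e)) ⟨rfl, rfl⟩ u

theorem closure_gens_toFlat (hXgen : ∀ v, Subgroup.closure (X v) = ⊤) :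
    Subgroup.closure (𝒢.toFlat T X Y L e₀).gens = ⊤ := by
  rw [eq_top_iff, ← PresentedGroup.closure_range_of, Subgroup.closure_le]
  rintro _ ⟨⟨v, g⟩ | e, rfl⟩
  · have h : (Subgroup.closure (X v)).map (𝒢.ofVertex T v) ≤
        Subgroup.closure (𝒢.toFlat T X Y L e₀).gens := by
      rw [MonoidHom.map_closure, Subgroup.closure_le]
      rintro _ ⟨a, ha, rfl⟩
      refine Subgroup.subset_closure (Or.inl ⟨v, single G v a, ⟨a, ha, rfl⟩, ?_⟩)
      change _ = 𝒢.ofVertex T v (single G v a v)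
      rw [single_apply_self]
    exact h ⟨g, by rw [hXgen]; trivial, rfl⟩
  · exact Subgroup.subset_closure (Or.inr ⟨e, rfl⟩)

end GraphOfGroups

end GOG

theorem theorem3p8 {V E : Type*} [Finite V] [Finite E] (Γ : GOG.DirGraph V E)
    (hΓ : Γ.Connected) (G : V → Type*) [∀ v, Group (G v)] (𝒢 : GOG.GraphOfGroups Γ G)
    (X : ∀ v, Set (G v)) (hXfin : ∀ v, (X v).Finite)
    (hXgen : ∀ v, Subgroup.closure (X v) = ⊤)
    (Y : ∀ e, Set (G (Γ.τ e))) (hYfin : ∀ e, (Y e).Finite)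
    (hYgen : ∀ e, Subgroup.closure (Y e) = 𝒢.edgeGroup e)
    (L : ∀ e, Language (G (Γ.τ e)))
    -- the edge generators are vertex generators
    (hYX : ∀ e, Y e ⊆ X (Γ.τ e))
    -- the coset languages
    (hL : ∀ e, ∃ K : ℕ, GOG.IsStrongSyncCosetSystem (X (Γ.τ e)) (𝒢.edgeGroup e) (L e) K)
    (hLgeo : ∀ e, ∀ w ∈ L e, w ∈ GOG.Geo (X (Γ.τ e)))
    (hLstart : ∀ e, ∀ w ∈ L e, ¬ ∃ (y : G (Γ.τ e)) (w' : List (G (Γ.τ e))),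
      (y ∈ Y e ∨ y⁻¹ ∈ Y e) ∧ w = y :: w')
    (hLone : ∀ e, ∀ w : List (G (Γ.τ e)), (w ∈ L e ∧ w.prod ∈ 𝒢.edgeGroup e) ↔ w = [])
    (hLdec : ∀ e, ∀ g : G (Γ.τ e), ∃ y z : List (G (Γ.τ e)),
      GOG.IsWordOver (Y e) y ∧ z ∈ L e ∧ (y ++ z) ∈ GOG.Geo (X (Γ.τ e)) ∧ (y ++ z).prod = g)
    -- 1-stability
    (hstable : ∀ e, GOG.IsStable 1 (𝒢.φ e) (Y e) (Y (Γ.bar e)))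
    -- limited crossover
    (hcross : ∀ (e f : E) (hef : Γ.τ e = Γ.τ f),
      GOG.HasLimitedCrossover (L e) (Y e) (hef ▸ Y f))
    -- the fundamental group is formed at any maximal tree
    (T : Set E) (hT : Γ.IsMaximalTree T) (e₀ : E) :
    GOG.StronglySyncCosetAutomatic (𝒢.edgeSubgroup T e₀) := by
  obtain ⟨Λ, K, hgood⟩ := 𝒢.good_toFlat (e₀ := e₀) hXfin hYgen hYX hL hLgeo hLone hLdec hstable
    hcross hT
  rw [← 𝒢.base_toFlat X Y L e₀]
  exact GOG.FlatGraph.stronglySyncCosetAutomatic hgood (fun v => (hXfin v).image _)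
    (𝒢.closure_gens_toFlat hXgen) (𝒢.exists_loop_of_mem_gens hT _)
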